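/- **Setting.** Let $N\ge 1$. For $v,w\in\mathbb R^N$ write $v\ge w$ if $v_i\ge w_i$ for all $i$; $v>w$ if $v\ge w$ and $v\ne w$; $v\gg w$ if $v_i>w_i$ for all $i$. Let $\|\cdot\|$ be the Euclidean norm and $e=(1,\dots,1)^\top$. A function $\gamma:\mathbb R_+\to\mathbb R_+$ is of class $\mathcal K_\infty$ if it is continuous, strictly increasing, unbounded and $\gamma(0)=0$. A monotone aggregation function is a continuous $\mu:\mathbb R^N_+\to\mathbb R_+$ with $\mu(s)=0\iff s=0$, with $\mu(s)<\mu(t)$ whenever $s\ll t$, and with $\mu(s)\to\infty$ as $\|s\|\to\infty$. Let $\Gamma=(\gamma_{ij})\in(\mathcal K_\infty\cup\{0\})^{N\times N}$ be a gain matrix, let $\mu_1,\dots,\mu_N$ be monotone aggregation functions, and put $$\Gamma_\mu:\mathbb R^N_+\to\mathbb R^N_+,\qquad \Gamma_\mu(s)_i=\mu_i(\gamma_{i1}(s_1),\dots,\gamma_{iN}(s_N)).$$ Assume that $\Gamma$ is irreducible (no simultaneous permutation of rows and columns brings the 0-1 matrix of its nonzero entries to block upper triangular form with two nonempty square diagonal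 blocks), and that the small gain condition $\Gamma_\mu(s)\not\ge s$ holds for all $s\in\mathbb R^N_+\setminus\{0\}$. Let $\kappa_0>0$, $\kappa_\Gamma>\kappa_h>0$ and, for $v\in\mathbb R^N_+$, $$\phi(v)=\Gamma_\mu(v)\Bigl(1+\min\Bigl\{0,\tfrac{\kappa_\Gamma-2\|v\|}{\|v\|+\kappa_0}\Bigr\}\Bigr)+\max\{0,\kappa_h-2\|v\|\}\,e .$$ Let $c\in\mathbb R^N_+$ with $\|c\|<\kappa_\Gamma/2$, and let $k\in\mathbb N$, $k\ge 1$, satisfy $\frac1{2k-1}\Gamma_\mu((\kappa_\Gamma+\kappa_0)e)<c$. **Triangulation.** The $K_1$ triangulation of $\mathbb R^n$ consists of the simplices with vertices $x^1\in\mathbb Z^n$, $x^{i+1}=x^i+e_{\pi(i)}$, $i=1,\dots,n$, with $\pi$ a permutation of $\{1,\dots,n\}$. For $\delta>0$, $\tilde K_1(\delta)$ is the set of those simplices of the $K_1$ triangulation of $\mathbb R^{N+1}$ that lie in $\mathbb R^N\times[0,1]$, with the first $N$ coordinates multiplied by $\delta$. Call $\delta$ *admissible* if $$0<\delta<\min\Bigl\{\frac{\kappa_\Gamma-\kappa_h}{2\sqrt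 N},\ \frac{\kappa_\Gamma+2\kappa_0}{2k\sqrt N}\Bigr\}$$ and $(c,0)$ lies in the relative interior of an $N$-simplex $\tau^0\subset\mathbb R^N\times\{0\}$ that is a facet of a simplex of $\tilde K_1(\delta)$; then $\tau^0$, and the $(N+1)$-simplex $\eta^0\in\tilde K_1(\delta)$ having $\tau^0$ as a facet, are unique. **Complete simplices.** For $y=(v,t)\in\mathbb R^N_+\times[0,1]$ put $l(y)=(1-t)c+t\phi(v)-v$. For an $N$-simplex $\tau=\langle y^1,\dots,y^{N+1}\rangle$ let $L(\tau)$ be the $(N+1)\times(N+1)$ matrix with columns $(1,l(y^j)^\top)^\top$. A facet $\tau$ with vertices in $\mathbb R^N_+\times\{0,1\}$ is *complete* if $L(\tau)W=I$ has a solution $W$ all of whose rows are lexicographically positive (the first nonzero entry is positive). Let $G$ be the graph whose nodes are the $(N+1)$-simplices of $\tilde K_1(\delta)$ having a complete facet, two distinct ones being adjacent if they share a complete facet. **Simplicial fixed point (SFP) algorithm.** Start with $(\eta^0,\tau^0)$. Given $(\eta^j,\tau^j)$, let $y^+$ be the vertex of $\eta^j$ not in $\tau^j$, let $W=L(\tau^j)^{-1}$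 and $p=W(1,l(y^+)^\top)^\top$, and let $\zeta$ be the index with $p_\zeta>0$ for which the row $W_\zeta/p_\zeta$ is lexicographically minimal among the rows $W_h/p_h$ with $p_h>0$. Let $\tau^{j+1}$ be the facet of $\eta^j$ opposite the vertex $y^\zeta$ of $\tau^j$. If $\tau^{j+1}\subset\mathbb R^N\times\{1\}$, stop; otherwise let $\eta^{j+1}\ne\eta^j$ be the other simplex of $\tilde K_1(\delta)$ with facet $\tau^{j+1}$, and repeat. If the algorithm stops with a facet $\tau=\langle y^1,\dots,y^{N+1}\rangle$, $y^j=(v^j,1)$, its output is $w=\sum_j\lambda_jv^j$, where $\lambda\ge0$ solves $L(\tau)\lambda=e_1$. **Theorem.** 1. For every admissible $\delta$ the SFP algorithm is well defined and stops after finitely many steps: its run is unique, visits $\eta^0,\dots,\eta^m$ for some $m\ge1$, and then stops with a facet $\tau^{m+1}\subset\mathbb R^N\times\{1\}$ of $\eta^m$. The facets $\tau^0,\dots,\tau^{m+1}$ are complete, the simplices $\eta^0,\dots,\eta^m$ are pairwise distinct and lie in $\mathbb R^N_+\times[0,1]$, and the connected component of $\eta^0$ in $G$ is exactly the finite simple path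 $\eta^0,\eta^1,\dots,\eta^m$. The algorithm has an output $w$. 2. Let $(\delta_n)$ be a sequence of admissible numbers with $\delta_n\to0$, and let $w_n$ be the output of the SFP algorithm for $\delta_n$. Then the outputs converge to the set $F=\{s\in\mathbb R^N_+ : \phi(s)=s,\ \Gamma_\mu(s)\ll s\}$ of fixed points of $\phi$ that are decay points of $\Gamma_\mu$, i.e. $\operatorname{dist}(w_n,F)\to0$; a subsequence of $(w_n)$ converges to a point $s\in F$, so that $\Gamma_\mu(s)\ll s$; every cluster point of $(w_n)$ lies in $F$; and for all sufficiently large $n$ the output $w_n$ is itself a decay point, $\Gamma_\mu(w_n)\ll w_n$. -/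

import Mathlib

open scoped NNReal

noncomputable section

namespace SFP

/-! ### Comparison functions, aggregation functions and the gain operator -/

/-- Class `K∞`: strictly increasing, continuous, zero at zero, unbounded. -/
def IsKInf (γ : ℝ≥0 → ℝ≥0) : Prop :=
  StrictMono γ ∧ Continuous γ ∧ γ 0 = 0 ∧ ¬ BddAbove (Set.range γ)

/-- The Euclidean norm on `ℝ^N`. -/
def euclNorm {N : ℕ} (v : Fin N → ℝ) : ℝ :=
  ‖(WithLp.toLp 2 v : EuclideanSpace ℝ (Fin N))‖

/-- The inclusion of the orthant `ℝ₊^N` in `ℝ^N`. -/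
def toReal {N : ℕ} (s : Fin N → ℝ≥0) : Fin N → ℝ := fun i => (s i : ℝ)

/-- A monotone aggregation function in `N` arguments. -/
structure IsMAF {N : ℕ} (μ : (Fin N → ℝ≥0) → ℝ≥0) : Prop where
  continuous : Continuous μ
  eq_zero_iff : ∀ s, μ s = 0 ↔ s = 0
  strict_increase : ∀ s t : Fin N → ℝ≥0, (∀ i, s i < t i) → μ s < μ t
  unbounded :
    Filter.Tendsto μ (Filter.comap (fun s => euclNorm (toReal s)) Filter.atTop) Filter.atTop

/-- A gain matrix: every entry is of class `K∞` or the zero function. -/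
def IsGainMatrix {N : ℕ} (Γ : Fin N → Fin N → ℝ≥0 → ℝ≥0) : Prop :=
  ∀ i j, IsKInf (Γ i j) ∨ Γ i j = 0

/-- The 0-1 matrix recording which gains are nonzero. -/
def adjMatrix {N : ℕ} (Γ : Fin N → Fin N → ℝ≥0 → ℝ≥0) : Matrix (Fin N) (Fin N) ℝ :=
  open Classical in Matrix.of fun i j => if Γ i j = 0 then 0 else 1

/-- `A` is irreducible: no simultaneous permutation of rows and columns brings `A` to a block
upper triangular form with two nonempty square diagonal blocks (of sizes `m` and `N - m`). -/
def IsIrreducibleMatrix {N : ℕ} (A : Matrix (Fin N) (Fin N) ℝ) : Prop :=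
  ¬ ∃ (σ : Equiv.Perm (Fin N)) (m : ℕ), 0 < m ∧ m < N ∧
    ∀ i j : Fin N, m ≤ i.val → j.val < m → A (σ i) (σ j) = 0

/-- The operator `Γ_μ(s)_i = μ_i(γ_{i1}(s_1), …, γ_{iN}(s_N))` on `ℝ₊^N`. -/
def gainOp {N : ℕ} (Γ : Fin N → Fin N → ℝ≥0 → ℝ≥0) (μ : Fin N → (Fin N → ℝ≥0) → ℝ≥0)
    (s : Fin N → ℝ≥0) : Fin N → ℝ≥0 :=
  fun i => μ i (fun j => Γ i j (s j))

/-- The small gain condition `T(s) ≱ s` for all `s ≥ 0`, `s ≠ 0`. -/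
def SmallGain {N : ℕ} (T : (Fin N → ℝ≥0) → (Fin N → ℝ≥0)) : Prop :=
  ∀ s, s ≠ 0 → ¬ s ≤ T s

/-- The set of decay `Ω(T) = {s : T(s) ≪ s}`. -/
def decaySet {N : ℕ} (T : (Fin N → ℝ≥0) → (Fin N → ℝ≥0)) : Set (Fin N → ℝ≥0) :=
  {s | ∀ i, T s i < s i}

/-- The function `φ(v) = T(v) (1 + min{0, (κΓ - 2‖v‖)/(‖v‖ + κ₀)}) + max{0, κh - 2‖v‖} e`.
Only its values on the orthant `ℝ₊^N`, where `Real.toNNReal` is the identity, are meaningful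
and used below. -/
def phi {N : ℕ} (T : (Fin N → ℝ≥0) → (Fin N → ℝ≥0)) (κ₀ κΓ κh : ℝ) (v : Fin N → ℝ) :
    Fin N → ℝ :=
  fun i => (T (fun j => (v j).toNNReal) i : ℝ) *
      (1 + min 0 ((κΓ - 2 * euclNorm v) / (euclNorm v + κ₀))) + max 0 (κh - 2 * euclNorm v)

/-! ### The triangulation

A simplex is represented by its finite set of vertices. A point of `ℝ^N × [0,1]` is a vector
`y : Fin (N + 1) → ℝ` whose last coordinate is the homotopy parameter `t`. -/

/-- The `K₁` triangulation of `ℝ^n`: vertices `x¹ ∈ ℤ^n` and `x^{i+1} = x^i + e_{π(i)}`. -/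
def K1 (n : ℕ) : Set (Finset (Fin n → ℝ)) :=
  {η | ∃ (x : Fin (n + 1) → Fin n → ℝ) (π : Equiv.Perm (Fin n)),
    (∃ z : Fin n → ℤ, ∀ j, x 0 j = (z j : ℝ)) ∧
    (∀ i : Fin n, x i.succ = x i.castSucc + Pi.single (π i) 1) ∧
    η = Finset.univ.image x}

/-- The restriction of the `K₁` triangulation of `ℝ^{N+1}` to `ℝ^N × [0,1]`. -/
def K1Strip (N : ℕ) : Set (Finset (Fin (N + 1) → ℝ)) :=
  {η | η ∈ K1 (N + 1) ∧ ∀ y ∈ η, 0 ≤ y (Fin.last N) ∧ y (Fin.last N) ≤ 1}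

/-- The linear map with matrix `P = [δe₁, …, δe_N, e_{N+1}]`. -/
def scaleP {N : ℕ} (δ : ℝ) (y : Fin (N + 1) → ℝ) : Fin (N + 1) → ℝ :=
  fun i => if i = Fin.last N then y i else δ * y i

/-- The two-layered triangulation of `ℝ^N × [0,1]` obtained from `K1Strip` by scaling. -/
def K1Tilde (N : ℕ) (δ : ℝ) : Set (Finset (Fin (N + 1) → ℝ)) :=
  {η | ∃ σ ∈ K1Strip N, η = σ.image (scaleP δ)}

/-- The projection `p₁(v, t) = v`. -/
def proj {N : ℕ} (y : Fin (N + 1) → ℝ) : Fin N → ℝ := fun i => y i.castSucc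

/-- All vertices (hence the simplex) lie on `ℝ^N × {t}`. -/
def OnLevel {N : ℕ} (t : ℝ) (τ : Finset (Fin (N + 1) → ℝ)) : Prop :=
  ∀ y ∈ τ, y (Fin.last N) = t

/-- All vertices (hence the simplex) have their first `N` coordinates in `ℝ₊^N`. -/
def InOrthant {N : ℕ} (τ : Finset (Fin (N + 1) → ℝ)) : Prop :=
  ∀ y ∈ τ, 0 ≤ proj y

/-! ### Labels and complete simplices -/

/-- The label `l(y) = ϑ(y) - p₁(y)` with the homotopy `ϑ(v, t) = (1 - t) c + t φ(v)`. -/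
def label {N : ℕ} (φ : (Fin N → ℝ) → (Fin N → ℝ)) (c : Fin N → ℝ) (y : Fin (N + 1) → ℝ) :
    Fin N → ℝ :=
  (1 - y (Fin.last N)) • c + y (Fin.last N) • φ (proj y) - proj y

/-- The column `(1, l(y))ᵀ`. -/
def labelCol {N : ℕ} (φ : (Fin N → ℝ) → (Fin N → ℝ)) (c : Fin N → ℝ) (y : Fin (N + 1) → ℝ) :
    Fin (N + 1) → ℝ :=
  Fin.cons 1 (label φ c y)

/-- The labeling matrix `L(τ)`, its columns indexed by the vertices of `τ`. -/
def labelMatrix {N : ℕ} (φ : (Fin N → ℝ) → (Fin N → ℝ)) (c : Fin N → ℝ)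
    (τ : Finset (Fin (N + 1) → ℝ)) : Matrix (Fin (N + 1)) τ ℝ :=
  Matrix.of fun r y => labelCol φ c (y : Fin (N + 1) → ℝ) r

/-- A row vector is lexicographically positive if its first nonzero entry is positive. -/
def LexPos {n : ℕ} (r : Fin n → ℝ) : Prop :=
  ∃ i, 0 < r i ∧ ∀ j, j < i → r j = 0

/-- An `N`-simplex `τ` (a set of `N + 1` vertices, in the domain `ℝ₊^N × [0,1]` of the labeling)
is complete if `L(τ) W = I` has a solution `W` all of whose rows are lexicographically positive. -/
def IsComplete {N : ℕ} (φ : (Fin N → ℝ) → (Fin N → ℝ)) (c : Fin N → ℝ)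
    (τ : Finset (Fin (N + 1) → ℝ)) : Prop :=
  τ.card = N + 1 ∧ InOrthant τ ∧
    ∃ W : Matrix τ (Fin (N + 1)) ℝ, labelMatrix φ c τ * W = 1 ∧ ∀ y, LexPos (W y)

/-- The graph of complete simplices: two distinct `(N+1)`-simplices of the triangulation are
adjacent if they share a complete facet. -/
def completeGraph {N : ℕ} (φ : (Fin N → ℝ) → (Fin N → ℝ)) (c : Fin N → ℝ) (δ : ℝ) :
    SimpleGraph (Finset (Fin (N + 1) → ℝ)) where
  Adj η η' := η ≠ η' ∧ η ∈ K1Tilde N δ ∧ η' ∈ K1Tilde N δ ∧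
    ∃ τ, IsComplete φ c τ ∧ τ ⊆ η ∧ τ ⊆ η'
  symm := ⟨fun _ _ h => ⟨h.1.symm, h.2.2.1, h.2.1, h.2.2.2.imp fun _ k => ⟨k.1, k.2.2, k.2.1⟩⟩⟩
  loopless := ⟨fun _ h => h.1 rfl⟩

/-- The connected component of `η 0` in `G` is the finite simple path `η 0, η 1, …, η m`. -/
def IsFiniteSimplePath {V : Type*} (G : SimpleGraph V) (m : ℕ) (η : ℕ → V) : Prop :=
  Set.InjOn η (Set.Iic m) ∧
  (∀ i ≤ m, ∀ j ≤ m, G.Adj (η i) (η j) ↔ (i + 1 = j ∨ j + 1 = i)) ∧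
  (∀ σ, G.Reachable (η 0) σ ↔ ∃ k ≤ m, η k = σ)

/-! ### The simplicial fixed point algorithm -/

/-- `τ` is an `N`-simplex of the triangulation on `ℝ^N × {0}` with `(c, 0)` in its (relative)
interior. -/
def IsInitialSimplex {N : ℕ} (c : Fin N → ℝ) (δ : ℝ) (τ : Finset (Fin (N + 1) → ℝ)) : Prop :=
  τ.card = N + 1 ∧ (∃ η ∈ K1Tilde N δ, τ ⊆ η) ∧ OnLevel 0 τ ∧
    c ∈ interior (convexHull ℝ (proj '' (τ : Set (Fin (N + 1) → ℝ))))

/-- `ζ` is the vertex of `τ` selected by the lexicographic pivoting rule: with `W = L(τ)⁻¹`, with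
`y⁺` the vertex of `η` outside `τ` and `p = W (1, l(y⁺))ᵀ`, the row `W_ζ / p_ζ` is the
lexicographic minimum of the rows `W_h / p_h` with `p_h > 0`. -/
def IsPivot {N : ℕ} (φ : (Fin N → ℝ) → (Fin N → ℝ)) (c : Fin N → ℝ)
    (η τ : Finset (Fin (N + 1) → ℝ)) (ζ : Fin (N + 1) → ℝ) : Prop :=
  ∃ W : Matrix τ (Fin (N + 1)) ℝ, labelMatrix φ c τ * W = 1 ∧
    ∃ y ∈ η \ τ, ∃ hζ : ζ ∈ τ,
      0 < W.mulVec (labelCol φ c y) ⟨ζ, hζ⟩ ∧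
      ∀ h : τ, h ≠ ⟨ζ, hζ⟩ → 0 < W.mulVec (labelCol φ c y) h →
        LexPos ((W.mulVec (labelCol φ c y) h)⁻¹ • W h -
          (W.mulVec (labelCol φ c y) ⟨ζ, hζ⟩)⁻¹ • W ⟨ζ, hζ⟩)

/-- The first `n` iterations of the algorithm on the triangulation `K1Tilde N δ`: it starts at the
`N`-simplex containing `(c, 0)` in its interior and the `(N+1)`-simplex having it as a facet;
iteration `k` passes to the facet of `η k` opposite the pivot vertex and, as this facet does not
lie on `ℝ^N × {1}`, to the other `(N+1)`-simplex sharing it. -/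
def IsRun {N : ℕ} (φ : (Fin N → ℝ) → (Fin N → ℝ)) (c : Fin N → ℝ) (δ : ℝ) (n : ℕ)
    (η τ : ℕ → Finset (Fin (N + 1) → ℝ)) : Prop :=
  IsInitialSimplex c δ (τ 0) ∧ η 0 ∈ K1Tilde N δ ∧ τ 0 ⊆ η 0 ∧
  ∀ k < n,
    (∃ ζ, IsPivot φ c (η k) (τ k) ζ ∧ τ (k + 1) = (η k).erase ζ) ∧
    ¬ OnLevel 1 (τ (k + 1)) ∧
    η (k + 1) ∈ K1Tilde N δ ∧ τ (k + 1) ⊆ η (k + 1) ∧ η (k + 1) ≠ η k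

/-- From `(η, τ)` the algorithm pivots to the facet `τ'`, which lies on `ℝ^N × {1}`, and stops. -/
def StopsAt {N : ℕ} (φ : (Fin N → ℝ) → (Fin N → ℝ)) (c : Fin N → ℝ)
    (η τ τ' : Finset (Fin (N + 1) → ℝ)) : Prop :=
  (∃ ζ, IsPivot φ c η τ ζ ∧ τ' = η.erase ζ) ∧ OnLevel 1 τ'

/-- `w` is the approximate fixed point `∑ λ_j v^j` given by the simplex `τ`, where `λ ≥ 0` solves
`L(τ) λ = e₁`. -/
def IsApproxFixedPoint {N : ℕ} (φ : (Fin N → ℝ) → (Fin N → ℝ)) (c : Fin N → ℝ)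
    (τ : Finset (Fin (N + 1) → ℝ)) (w : Fin N → ℝ) : Prop :=
  ∃ lam : τ → ℝ, (∀ y, 0 ≤ lam y) ∧
    (labelMatrix φ c τ).mulVec lam = Pi.single 0 1 ∧
    w = ∑ y : τ, lam y • proj (y : Fin (N + 1) → ℝ)

/-- `w` is the approximate fixed point returned by the algorithm on `K1Tilde N δ`. -/
def IsOutput {N : ℕ} (φ : (Fin N → ℝ) → (Fin N → ℝ)) (c : Fin N → ℝ) (δ : ℝ)
    (w : Fin N → ℝ) : Prop :=
  ∃ (m : ℕ) (η τ : ℕ → Finset (Fin (N + 1) → ℝ)) (τ' : Finset (Fin (N + 1) → ℝ)),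
    IsRun φ c δ m η τ ∧ StopsAt φ c (η m) (τ m) τ' ∧ IsApproxFixedPoint φ c τ' w

/-- The admissible mesh parameters: `δ > 0` is below the bound of the convergence result, and
`(c, 0)` lies in the interior of an `N`-simplex of the triangulation on `ℝ^N × {0}`. -/
def Admissible {N : ℕ} (κ₀ κΓ κh : ℝ) (k : ℕ) (c : Fin N → ℝ) (δ : ℝ) : Prop :=
  0 < δ ∧
  δ < min ((κΓ - κh) / (2 * Real.sqrt N)) ((κΓ + 2 * κ₀) / (2 * k * Real.sqrt N)) ∧
  ∃ τ, IsInitialSimplex c δ τ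

end SFP

end

/-!
The algorithm follows a path of complete facets, and three facts make the path-following argument
work.

*Pivoting.* A complete facet is a lexicographically positive basis for the label columns. Exchanging
one basis column for the column of the remaining vertex keeps the inverse lexicographically positive
exactly when the leaving column is the one chosen by the pivoting rule (`IsDual.pivot`,
`IsDual.isLexMin_of_exchange`). The choice is unique because two rows of an invertible matrix are
never proportional, and it exists because the coordinates of the entering column add up to one. So a
simplex of the orthant with a complete facet has exactly two complete facets
(`exists_other_facet`).

*The triangulation.* A `K₁` simplex is a maximal chain from an integer point `z` to `z + (1, …, 1)`.
A point completing a facet to a `K₁` simplex is comparable to all vertices of the facet, and the sum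
of its coordinates leaves just two candidates (`eq_or_eq_oppVert`). So a facet inside the strip
belongs to exactly two simplices and one on the upper boundary to a single one
(`exists_other_simplex`, `eq_of_onLevel_one`). A complete facet on the lower boundary contains `c`,
so it is the starting one, as the integer parts of the coordinates of `c / δ` and the order of their
fractional parts determine the simplex (`initial_unique`).

*Estimates.* A complete facet carries weights that express a point as a convex combination both of
the vertices and of the values of the homotopy. If some vertex had norm at least `κΓ + κ₀`, then the
mesh bound would give `φ ≤ c` at all vertices, and the point would have norm at most
`‖c‖ < κΓ / 2`, which is too far from that vertex (`Setting.norm_lt`). This keeps the path in a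
finite set of simplices and makes the factor of `Γ_μ` in `φ` positive. If a complete facet lay in a
coordinate hyperplane, then by irreducibility all vertices with positive weight would be the origin
of the upper boundary, where `φ` is positive (`Setting.exists_proj_ne_zero`). So the path stays in
the orthant.

With complete facets as doors and simplices as rooms, the component of the starting simplex is a
finite path whose other end has a door in the upper boundary (`DoorSystem`).

For the convergence, an output is a convex combination of values of `φ` at points within `δ` of it,
so cluster points are fixed points of `φ` by continuity. A fixed point of norm at least `κh / 2`
would be a nonzero `s` with `s ≤ Γ_μ(s)`, against the small gain condition. Inside the smaller ball
the additional term of `φ` is positive, so a fixed point there is a decay point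
(`Setting.decay_of_fixed`). The rest follows by compactness and because decay is an open condition.
-/

open scoped NNReal

namespace SFP

/-! ### Lexicographic positivity -/

theorem lexPos_iff {n : ℕ} {r : Fin n → ℝ} : LexPos r ↔ 0 < toLex r := by
  constructor
  · rintro ⟨i, hi, h⟩
    exact ⟨i, fun j hj => (h j hj).symm, hi⟩
  · rintro ⟨i, h, hi⟩
    exact ⟨i, hi, fun j hj => (h j hj).symm⟩

theorem LexPos.add {n : ℕ} {r s : Fin n → ℝ} (hr : LexPos r) (hs : LexPos s) :
    LexPos (r + s) := by
  rw [lexPos_iff] at *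
  exact add_pos hr hs

theorem LexPos.smul {n : ℕ} {r : Fin n → ℝ} (hr : LexPos r) {a : ℝ} (ha : 0 < a) :
    LexPos (a • r) := by
  obtain ⟨i, hi, h⟩ := hr
  exact ⟨i, mul_pos ha hi, fun j hj => by simp [h j hj]⟩

theorem LexPos.not_neg {n : ℕ} {r : Fin n → ℝ} (hr : LexPos r) : ¬ LexPos (-r) := by
  intro h
  have := hr.add h
  rw [add_neg_cancel, lexPos_iff] at this
  exact lt_irrefl _ this

theorem lexPos_sub_iff {n : ℕ} {r s : Fin n → ℝ} : LexPos (r - s) ↔ toLex s < toLex r := by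
  rw [lexPos_iff]
  exact sub_pos (a := toLex r) (b := toLex s)

theorem LexPos.zero_le {n : ℕ} {r : Fin (n + 1) → ℝ} (hr : LexPos r) : 0 ≤ r 0 := by
  obtain ⟨i, hi, h⟩ := hr
  rcases Fin.eq_zero_or_eq_succ i with rfl | ⟨j, rfl⟩
  · exact hi.le
  · exact (h 0 (Fin.succ_pos j)).ge

/-! ### Lexicographic bases and the pivot step -/

section Pivot

variable {α : Type*} {n : ℕ}

/-- The columns `a y`, `y ∈ τ`, form a square matrix which has the matrix with rows `W y`, `y ∈ τ`,
as its inverse. -/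
def IsDual (a : α → Fin n → ℝ) (τ : Finset α) (W : α → Fin n → ℝ) : Prop :=
  τ.card = n ∧ ∀ r s, ∑ y ∈ τ, a y r * W y s = if r = s then 1 else 0

/-- The coordinates of the vector `b` with respect to the columns `a y`, `y ∈ τ`. -/
def dualCoord (W : α → Fin n → ℝ) (b : Fin n → ℝ) (y : α) : ℝ := ∑ s, W y s * b s

theorem IsDual.sum_dualCoord {a W : α → Fin n → ℝ} {τ : Finset α} (h : IsDual a τ W)
    (b : Fin n → ℝ) (r : Fin n) : ∑ y ∈ τ, dualCoord W b y * a y r = b r := by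
  unfold dualCoord
  simp_rw [Finset.sum_mul]
  rw [Finset.sum_comm]
  have : ∀ s, ∑ y ∈ τ, W y s * b s * a y r = (if r = s then 1 else 0) * b s := by
    intro s
    rw [← h.2 r s, Finset.sum_mul]
    exact Finset.sum_congr rfl fun y _ => by ring
  simp [this]

/-- The lexicographic pivoting rule for the dual pair `(a, W)` on `τ` and the entering vector `b`. -/
def IsLexMin (τ : Finset α) (W : α → Fin n → ℝ) (b : Fin n → ℝ) (ζ : α) : Prop :=
  ζ ∈ τ ∧ 0 < dualCoord W b ζ ∧ ∀ h ∈ τ, h ≠ ζ → 0 < dualCoord W b h →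
    LexPos ((dualCoord W b h)⁻¹ • W h - (dualCoord W b ζ)⁻¹ • W ζ)

theorem IsLexMin.unique {τ : Finset α} {W : α → Fin n → ℝ} {b : Fin n → ℝ} {ζ ζ' : α}
    (h : IsLexMin τ W b ζ) (h' : IsLexMin τ W b ζ') : ζ = ζ' := by
  by_contra hne
  have h1 := h.2.2 ζ' h'.1 (Ne.symm hne) h'.2.1
  have h2 := h'.2.2 ζ h.1 hne h.2.1
  rw [lexPos_sub_iff] at h1 h2
  exact lt_asymm h1 h2

variable [DecidableEq α]

theorem IsDual.left {a W : α → Fin n → ℝ} {τ : Finset α} (h : IsDual a τ W) {y y' : α}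
    (hy : y ∈ τ) (hy' : y' ∈ τ) : ∑ s, W y s * a y' s = if y = y' then 1 else 0 := by
  let A : Matrix (Fin n) τ ℝ := Matrix.of fun r y => a y r
  let B : Matrix τ (Fin n) ℝ := Matrix.of fun y s => W y s
  have hAB : A * B = 1 := by
    ext r s
    rw [Matrix.mul_apply, Matrix.one_apply, ← h.2 r s, ← Finset.sum_coe_sort τ]
    rfl
  have hBA : B * A = 1 := (Matrix.mul_eq_one_comm_of_card_eq (Fin n) τ ℝ (by simp [h.1])).1 hAB
  have := congrFun (congrFun hBA ⟨y, hy⟩) ⟨y', hy'⟩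
  rw [Matrix.mul_apply, Matrix.one_apply] at this
  simpa [A, B] using this

theorem IsDual.unique {a W V : α → Fin n → ℝ} {τ : Finset α} (h : IsDual a τ W)
    (hV : ∀ r s, ∑ y ∈ τ, a y r * V y s = if r = s then 1 else 0) {y : α} (hy : y ∈ τ) :
    V y = W y := by
  funext s
  have h1 : ∑ r, W y r * ∑ y' ∈ τ, a y' r * V y' s = W y s := by
    simp [hV]
  rw [← h1]
  simp_rw [Finset.mul_sum]
  rw [Finset.sum_comm]
  have : ∀ y' ∈ τ, ∑ r, W y r * (a y' r * V y' s) = (if y = y' then 1 else 0) * V y' s := by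
    intro y' hy'
    rw [← h.left hy hy', Finset.sum_mul]
    exact Finset.sum_congr rfl fun r _ => by ring
  rw [Finset.sum_congr rfl this]
  simp [hy]

/-- Replacing the column `ζ` selected by the pivoting rule by the entering column preserves
lexicographic positivity of the inverse. -/
theorem IsDual.pivot {a W : α → Fin n → ℝ} {τ : Finset α} (h : IsDual a τ W)
    (hW : ∀ y ∈ τ, LexPos (W y)) {y₁ ζ : α} (hy₁ : y₁ ∉ τ) (hζ : IsLexMin τ W (a y₁) ζ) :
    ∃ V, IsDual a ((insert y₁ τ).erase ζ) V ∧ ∀ y ∈ (insert y₁ τ).erase ζ, LexPos (V y) := by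
  obtain ⟨hζτ, hpos, hmin⟩ := hζ
  set p := dualCoord W (a y₁) with hp
  have hne : y₁ ≠ ζ := fun h' => hy₁ (h' ▸ hζτ)
  have hset : (insert y₁ τ).erase ζ = insert y₁ (τ.erase ζ) :=
    Finset.erase_insert_of_ne hne
  have hy₁' : y₁ ∉ τ.erase ζ := fun h' => hy₁ (Finset.mem_of_mem_erase h')
  refine ⟨fun y => if y = y₁ then (p ζ)⁻¹ • W ζ else W y - p y • ((p ζ)⁻¹ • W ζ), ⟨?_, ?_⟩, ?_⟩
  · rw [hset, Finset.card_insert_of_notMem hy₁', Finset.card_erase_of_mem hζτ, h.1]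
    have : 0 < τ.card := Finset.card_pos.2 ⟨ζ, hζτ⟩
    have := h.1
    omega
  · intro r s
    rw [hset, Finset.sum_insert hy₁', ← h.2 r s]
    have h1 : ∀ y ∈ τ.erase ζ, a y r * (if y = y₁ then (p ζ)⁻¹ • W ζ
        else W y - p y • ((p ζ)⁻¹ • W ζ)) s
        = a y r * W y s - (p y * a y r) * ((p ζ)⁻¹ * W ζ s) := by
      intro y hy
      rw [if_neg (fun h' : y = y₁ => hy₁' (h' ▸ hy))]
      simp only [Pi.sub_apply, Pi.smul_apply, smul_eq_mul]
      ring
    rw [Finset.sum_congr rfl h1, Finset.sum_sub_distrib, ← Finset.sum_mul]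
    have h2 := h.sum_dualCoord (a y₁) r
    rw [← Finset.add_sum_erase _ _ hζτ, ← hp] at h2
    rw [← Finset.add_sum_erase _ (fun y => a y r * W y s) hζτ, ← h2]
    simp only [if_true, Pi.smul_apply, smul_eq_mul]
    field_simp
    ring
  · intro y hy
    rw [hset, Finset.mem_insert] at hy
    by_cases hyy : y = y₁
    · simp only [hyy, if_true]
      exact (hW ζ hζτ).smul (inv_pos.2 hpos)
    · simp only [hyy, if_false]
      have hy' := hy.resolve_left hyy
      have hyτ := Finset.mem_of_mem_erase hy'
      rcases lt_trichotomy (p y) 0 with hneg | h0 | hpy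
      · have : W y - p y • ((p ζ)⁻¹ • W ζ) = W y + (-p y * (p ζ)⁻¹) • W ζ := by
          rw [← mul_smul, neg_mul, neg_smul, sub_eq_add_neg]
        rw [this]
        exact (hW y hyτ).add ((hW ζ hζτ).smul (mul_pos (neg_pos.2 hneg) (inv_pos.2 hpos)))
      · rw [h0, zero_smul, sub_zero]
        exact hW y hyτ
      · have := (hmin y hyτ (Finset.ne_of_mem_erase hy') hpy).smul hpy
        rwa [smul_sub, smul_inv_smul₀ hpy.ne'] at this

/-- If exchanging `ζ` for the entering vector preserves lexicographic positivity, then `ζ` is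
selected by the pivoting rule. -/
theorem IsDual.isLexMin_of_exchange {a W V : α → Fin n → ℝ} {τ : Finset α} (h : IsDual a τ W)
    (hW : ∀ y ∈ τ, LexPos (W y)) {y₁ ζ : α} (hy₁ : y₁ ∉ τ) (hζ : ζ ∈ τ)
    (hV : IsDual a ((insert y₁ τ).erase ζ) V)
    (hVpos : ∀ y ∈ (insert y₁ τ).erase ζ, LexPos (V y)) : IsLexMin τ W (a y₁) ζ := by
  set p := dualCoord W (a y₁) with hp
  have hne : y₁ ≠ ζ := fun h' => hy₁ (h' ▸ hζ)
  have hset : (insert y₁ τ).erase ζ = insert y₁ (τ.erase ζ) :=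
    Finset.erase_insert_of_ne hne
  have hy₁' : y₁ ∉ τ.erase ζ := fun h => hy₁ (Finset.mem_of_mem_erase h)
  rw [hset] at hV hVpos
  -- Substituting the expansion of the entering column turns the inverse on the new index set into
  -- an inverse on the old one.
  have key : ∀ r s, ∑ y ∈ τ, a y r * ((if y = ζ then 0 else V y) + p y • V y₁) s
      = if r = s then 1 else 0 := by
    intro r s
    rw [← hV.2 r s, Finset.sum_insert hy₁', ← h.sum_dualCoord (a y₁) r, ← hp, Finset.sum_mul,
      ← Finset.add_sum_erase τ (fun y => a y r * _) hζ, ← Finset.add_sum_erase τ _ hζ]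
    have : ∀ y ∈ τ.erase ζ, a y r * ((if y = ζ then 0 else V y) + p y • V y₁) s
        = a y r * V y s + p y * a y r * V y₁ s := by
      intro y hy
      rw [if_neg (Finset.ne_of_mem_erase hy)]
      simp only [Pi.add_apply, Pi.smul_apply, smul_eq_mul]
      ring
    rw [Finset.sum_congr rfl this, Finset.sum_add_distrib]
    simp only [if_true, Pi.add_apply, Pi.smul_apply, smul_eq_mul, Pi.zero_apply]
    ring
  have hWζ : p ζ • V y₁ = W ζ := by
    have := h.unique (V := fun y => (if y = ζ then 0 else V y) + p y • V y₁) key hζ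
    simpa using this
  have hWy : ∀ y ∈ τ, y ≠ ζ → V y + p y • V y₁ = W y := by
    intro y hy hyζ
    have := h.unique (V := fun y => (if y = ζ then 0 else V y) + p y • V y₁) key hy
    simpa [hyζ] using this
  have hV₁ : LexPos (V y₁) := hVpos y₁ (Finset.mem_insert_self _ _)
  have hWζpos := hW ζ hζ
  have hpos : 0 < p ζ := by
    rcases lt_trichotomy (p ζ) 0 with hneg | h0 | hpy
    · exfalso
      have := hV₁.smul (neg_pos.2 hneg)
      rw [neg_smul, hWζ] at this
      exact hWζpos.not_neg this
    · exfalso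
      rw [← hWζ, h0, zero_smul] at hWζpos
      obtain ⟨i, hi, _⟩ := hWζpos
      exact lt_irrefl _ hi
    · exact hpy
  refine ⟨hζ, hpos, fun y hy hyζ hpy => ?_⟩
  rw [← hWζ, inv_smul_smul₀ (ne_of_gt hpos), ← hWy y hy hyζ, smul_add,
    inv_smul_smul₀ (ne_of_gt hpy), add_sub_cancel_right]
  exact (hVpos y (Finset.mem_insert_of_mem (Finset.mem_erase.2 ⟨hyζ, hy⟩))).smul (inv_pos.2 hpy)

/-- The pivoting rule selects an index as soon as some coordinate of the entering vector is
positive. Ties cannot occur because the rows of an invertible matrix are pairwise non-proportional. -/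
theorem IsDual.exists_isLexMin {a W : α → Fin n → ℝ} {τ : Finset α} (h : IsDual a τ W)
    {b : Fin n → ℝ} (hb : ∃ y ∈ τ, 0 < dualCoord W b y) : ∃ ζ, IsLexMin τ W b ζ := by
  obtain ⟨y, hy, hyp⟩ := hb
  obtain ⟨ζ, hζ, hmin⟩ := Finset.exists_min_image (τ.filter fun y => 0 < dualCoord W b y)
    (fun y => toLex ((dualCoord W b y)⁻¹ • W y)) ⟨y, Finset.mem_filter.2 ⟨hy, hyp⟩⟩
  rw [Finset.mem_filter] at hζ
  refine ⟨ζ, hζ.1, hζ.2, fun y hy hne hp => ?_⟩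
  rw [lexPos_sub_iff]
  refine lt_of_le_of_ne (hmin y (Finset.mem_filter.2 ⟨hy, hp⟩)) fun heq => ?_
  have heq' : (dualCoord W b ζ)⁻¹ • W ζ = (dualCoord W b y)⁻¹ • W y := toLex.injective heq
  have h1 := h.left hy hy
  have h2 := h.left hζ.1 hy
  rw [if_pos rfl] at h1
  rw [if_neg hne.symm] at h2
  have h3 : ∑ s, ((dualCoord W b ζ)⁻¹ • W ζ) s * a y s = 0 := by
    simp only [Pi.smul_apply, smul_eq_mul, mul_assoc, ← Finset.mul_sum, h2, mul_zero]
  rw [heq'] at h3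
  simp only [Pi.smul_apply, smul_eq_mul, mul_assoc, ← Finset.mul_sum, h1, mul_one] at h3
  exact (inv_pos.2 hp).ne' h3

end Pivot

/-! ### Paths through doors -/

section Doors

variable {R D : Type*}

/-- A walk through rooms `r k` and doors `d k`: it enters `r k` by `d k`, leaves it by another door
`d (k + 1)`, which is not an exit, and arrives in another room. -/
def IsDoorWalk (inc : D → R → Prop) (exit : D → Prop) (r₀ : R) (d₀ : D) (n : ℕ)
    (r : ℕ → R) (d : ℕ → D) : Prop :=
  r 0 = r₀ ∧ d 0 = d₀ ∧ ∀ k < n, (inc (d (k + 1)) (r k) ∧ d (k + 1) ≠ d k) ∧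
    ¬ exit (d (k + 1)) ∧ inc (d (k + 1)) (r (k + 1)) ∧ r (k + 1) ≠ r k

/-- The incidence structure behind path-following: every room with a door has exactly two doors,
the entrance `d₀` leads to `r₀` only, an exit leads to one room only, and every other door connects
exactly two rooms. -/
structure DoorSystem (inc : D → R → Prop) (exit : D → Prop) (r₀ : R) (d₀ : D) : Prop where
  start : inc d₀ r₀
  not_exit : ¬ exit d₀
  start_unique : ∀ r, inc d₀ r → r = r₀
  exit_unique : ∀ d r r', exit d → inc d r → inc d r' → r = r'
  two_doors : ∀ r d, inc d r → ∃ d', inc d' r ∧ d' ≠ d ∧ ∀ d'', inc d'' r → d'' = d ∨ d'' = d'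
  two_rooms : ∀ d r, inc d r → ¬ exit d → d ≠ d₀ →
    ∃ r', inc d r' ∧ r' ≠ r ∧ ∀ r'', inc d r'' → r'' = r ∨ r'' = r'
  finite : {r | ∃ d, inc d r}.Finite

namespace DoorSystem

variable {inc : D → R → Prop} {exit : D → Prop} {r₀ : R} {d₀ : D}

theorem inc_walk (S : DoorSystem inc exit r₀ d₀) {n : ℕ} {r : ℕ → R} {d : ℕ → D}
    (h : IsDoorWalk inc exit r₀ d₀ n r d) {k : ℕ} (hk : k ≤ n) : inc (d k) (r k) := by
  cases k with
  | zero => rw [h.1, h.2.1]; exact S.start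
  | succ k => exact (h.2.2 k hk).2.2.1

theorem other_door (S : DoorSystem inc exit r₀ d₀) {r : R} {d d' d'' : D} (h : inc d r)
    (h' : inc d' r) (hne : d' ≠ d) (h'' : inc d'' r) : d'' = d ∨ d'' = d' := by
  obtain ⟨e, he, hed, hall⟩ := S.two_doors r d h
  have h1 := (hall d' h').resolve_left hne
  rw [h1]
  exact hall d'' h''

/-- The rooms adjoining the `k`-th door of a walk. -/
theorem room_of_door (S : DoorSystem inc exit r₀ d₀) {n : ℕ} {r : ℕ → R} {d : ℕ → D}
    (h : IsDoorWalk inc exit r₀ d₀ n r d) {k : ℕ} (hk : k ≤ n) {ρ : R} (hρ : inc (d k) ρ) :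
    ρ = r k ∨ ∃ j, k = j + 1 ∧ ρ = r j := by
  cases k with
  | zero =>
    left
    rw [h.1]
    exact S.start_unique ρ (h.2.1 ▸ hρ)
  | succ k =>
    obtain ⟨⟨h1, h2⟩, h3, h4, h5⟩ := h.2.2 k hk
    by_cases hd : d (k + 1) = d₀
    · exact absurd ((S.start_unique _ (hd ▸ h4)).trans (S.start_unique _ (hd ▸ h1)).symm) h5
    · obtain ⟨r', _, _, hall⟩ := S.two_rooms _ _ h1 h3 hd
      have := (hall _ h4).resolve_left h5
      rcases hall ρ hρ with h6 | h6
      · exact Or.inr ⟨k, rfl, h6⟩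
      · exact Or.inl (h6.trans this.symm)

/-- No room is visited twice: a first return would use a third door of a room visited before. -/
theorem walk_injOn (S : DoorSystem inc exit r₀ d₀) {n : ℕ} {r : ℕ → R} {d : ℕ → D}
    (h : IsDoorWalk inc exit r₀ d₀ n r d) : Set.InjOn r (Set.Iic n) := by
  suffices H : ∀ n, IsDoorWalk inc exit r₀ d₀ n r d → ∀ j < n, r n ≠ r j by
    intro i hi j hj hij
    rcases lt_trichotomy i j with hlt | heq | hlt
    · exact absurd hij.symm (H j ⟨h.1, h.2.1, fun k hk => h.2.2 k (hk.trans_le hj)⟩ i hlt)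
    · exact heq
    · exact absurd hij (H i ⟨h.1, h.2.1, fun k hk => h.2.2 k (hk.trans_le hi)⟩ j hlt)
  intro n
  induction n using Nat.strong_induction_on with
  | _ n ih =>
    intro h j hj heq
    obtain ⟨n, rfl⟩ : ∃ n', n = n' + 1 := ⟨n - 1, by omega⟩
    obtain ⟨⟨h1, h2⟩, h3, h4, h5⟩ := h.2.2 n (Nat.lt_succ_self n)
    have hsub : ∀ k ≤ n + 1, IsDoorWalk inc exit r₀ d₀ k r d := fun k hk =>
      ⟨h.1, h.2.1, fun i hi => h.2.2 i (hi.trans_le hk)⟩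
    have hjn : j < n := by
      refine lt_of_le_of_ne (Nat.lt_succ_iff.1 hj) ?_
      rintro rfl
      exact h5 heq
    have hinj : ∀ i ≤ n, r n = r i → i = n := by
      intro i hi h6
      by_contra hne
      exact ih n (Nat.lt_succ_self n) (hsub n (Nat.le_succ n)) i (lt_of_le_of_ne hi hne) h6
    -- The door `d (n + 1)` of the room `r j` is one of its two doors `d j` and `d (j + 1)`.
    obtain ⟨⟨g1, g2⟩, -, -, -⟩ := h.2.2 j hj
    have hdj := S.inc_walk h hj.le
    rcases S.other_door hdj g1 g2 (heq ▸ h4) with h6 | h6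
    · rcases S.room_of_door h hj.le (h6 ▸ h1) with h7 | ⟨i, hi, h7⟩
      · exact hjn.ne (hinj j hjn.le h7)
      · have := hinj i (by omega) h7
        omega
    · rcases S.room_of_door h (k := j + 1) hj (h6 ▸ h1) with h7 | ⟨i, hi, h7⟩
      · have := hinj (j + 1) hjn h7
        exact h2 (by rw [h6, this])
      · have := hinj i (by omega) h7
        omega

/-- Two walks agree as long as both go on. -/
theorem walk_unique (S : DoorSystem inc exit r₀ d₀) {n : ℕ} {r r' : ℕ → R} {d d' : ℕ → D}
    (h : IsDoorWalk inc exit r₀ d₀ n r d) (h' : IsDoorWalk inc exit r₀ d₀ n r' d') :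
    ∀ j ≤ n, r' j = r j ∧ d' j = d j := by
  intro j
  induction j with
  | zero => exact fun _ => ⟨h'.1.trans h.1.symm, h'.2.1.trans h.2.1.symm⟩
  | succ j ih =>
    intro hj
    obtain ⟨hr, hd⟩ := ih (Nat.le_of_succ_le hj)
    obtain ⟨⟨h1, h2⟩, h3, h4, h5⟩ := h.2.2 j hj
    obtain ⟨⟨g1, g2⟩, g3, g4, g5⟩ := h'.2.2 j hj
    rw [hr] at g1 g5
    rw [hd] at g2
    have hdd : d' (j + 1) = d (j + 1) :=
      (S.other_door (S.inc_walk h (Nat.le_of_succ_le hj)) h1 h2 g1).resolve_left g2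
    refine ⟨?_, hdd⟩
    rcases S.room_of_door h hj (hdd ▸ g4) with h6 | ⟨i, hi, h6⟩
    · exact h6
    · obtain rfl : j = i := by omega
      exact absurd h6 g5

/-- The walk never gets stuck: it can be continued unless the next door is an exit. -/
theorem walk_continue (S : DoorSystem inc exit r₀ d₀) {n : ℕ} {r : ℕ → R} {d : ℕ → D}
    (h : IsDoorWalk inc exit r₀ d₀ n r d) :
    (∃ d', inc d' (r n) ∧ d' ≠ d n ∧ exit d') ∨
      ∃ r' d', IsDoorWalk inc exit r₀ d₀ (n + 1) r' d' := by
  classical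
  obtain ⟨d', h1, h2, -⟩ := S.two_doors _ _ (S.inc_walk h le_rfl)
  by_cases hd : exit d'
  · exact Or.inl ⟨d', h1, h2, hd⟩
  right
  have hd₀ : d' ≠ d₀ := by
    intro h3
    have h4 := S.start_unique _ (h3 ▸ h1)
    have h5 : n = 0 := S.walk_injOn h (Set.mem_Iic.2 le_rfl) (Set.mem_Iic.2 (Nat.zero_le n))
      (h4.trans h.1.symm)
    exact h2 (by rw [h3, h5, h.2.1])
  obtain ⟨r', h3, h4, -⟩ := S.two_rooms _ _ h1 hd hd₀
  refine ⟨Function.update r (n + 1) r', Function.update d (n + 1) d', ?_, ?_, ?_⟩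
  · rw [Function.update_of_ne (by omega), h.1]
  · rw [Function.update_of_ne (by omega), h.2.1]
  · intro k hk
    rcases Nat.lt_succ_iff_lt_or_eq.1 hk with hk' | rfl
    · rw [Function.update_of_ne (by omega), Function.update_of_ne (by omega),
        Function.update_of_ne (by omega), Function.update_of_ne (by omega)]
      exact h.2.2 k hk'
    · rw [Function.update_self, Function.update_self, Function.update_of_ne (by omega),
        Function.update_of_ne (by omega)]
      exact ⟨⟨h1, h2⟩, hd, h3, h4⟩

/-- The walk ends at an exit because there are only finitely many rooms with doors. -/
theorem exists_walk_exit (S : DoorSystem inc exit r₀ d₀) :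
    ∃ n r d d', IsDoorWalk inc exit r₀ d₀ n r d ∧ inc d' (r n) ∧ d' ≠ d n ∧ exit d' := by
  by_contra hcon
  push Not at hcon
  have hall : ∀ n, ∃ r d, IsDoorWalk inc exit r₀ d₀ n r d := by
    intro n
    induction n with
    | zero => exact ⟨fun _ => r₀, fun _ => d₀, rfl, rfl, fun k hk => absurd hk (Nat.not_lt_zero k)⟩
    | succ n ih =>
      obtain ⟨r, d, h⟩ := ih
      rcases S.walk_continue h with ⟨d', h1, h2, h3⟩ | h1
      · exact absurd h3 (hcon n r d d' h h1 h2)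
      · exact h1
  obtain ⟨r, d, h⟩ := hall S.finite.toFinset.card
  have h1 := Finset.card_le_card_of_injOn (s := Finset.Iic S.finite.toFinset.card)
    (t := S.finite.toFinset) r
    (fun k hk => by
      rw [Finset.coe_Iic, Set.mem_Iic] at hk
      simpa using ⟨d k, S.inc_walk h hk⟩)
    (by simpa using S.walk_injOn h)
  rw [Nat.card_Iic] at h1
  omega

theorem walk_le (S : DoorSystem inc exit r₀ d₀) {m n : ℕ} {r r' : ℕ → R} {d d' : ℕ → D} {e : D}
    (h : IsDoorWalk inc exit r₀ d₀ m r d) (he : inc e (r m)) (hne : e ≠ d m) (hex : exit e)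
    (h' : IsDoorWalk inc exit r₀ d₀ n r' d') : n ≤ m := by
  by_contra hlt
  push Not at hlt
  have h'' : IsDoorWalk inc exit r₀ d₀ m r' d' :=
    ⟨h'.1, h'.2.1, fun k hk => h'.2.2 k (hk.trans hlt)⟩
  obtain ⟨hr, hd⟩ := S.walk_unique h h'' m le_rfl
  obtain ⟨⟨h1, h2⟩, h3, h4, h5⟩ := h'.2.2 m hlt
  rw [hr] at h1
  rw [hd] at h2
  exact h3 ((S.other_door (S.inc_walk h le_rfl) he hne h1).resolve_left h2 ▸ hex)

/-- The rooms of a walk that has reached an exit form a connected component, which is a path. -/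
theorem isFiniteSimplePath (S : DoorSystem inc exit r₀ d₀) (G : SimpleGraph R)
    (hG : ∀ a b, G.Adj a b ↔ a ≠ b ∧ ∃ d, inc d a ∧ inc d b) {m : ℕ} {r : ℕ → R} {d : ℕ → D}
    {e : D} (h : IsDoorWalk inc exit r₀ d₀ m r d) (he : inc e (r m)) (hne : e ≠ d m)
    (hex : exit e) : IsFiniteSimplePath G m r := by
  have hinj := S.walk_injOn h
  have hadj : ∀ k < m, G.Adj (r k) (r (k + 1)) := by
    intro k hk
    obtain ⟨⟨h1, h2⟩, h3, h4, h5⟩ := h.2.2 k hk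
    exact (hG _ _).2 ⟨h5.symm, _, h1, h4⟩
  have hnbr : ∀ i ≤ m, ∀ σ, G.Adj (r i) σ →
      (∃ j, i = j + 1 ∧ σ = r j) ∨ (i < m ∧ σ = r (i + 1)) := by
    intro i hi σ hσ
    obtain ⟨hneq, f, hf, hfσ⟩ := (hG _ _).1 hσ
    have hdi := S.inc_walk h hi
    have hback : f = d i → (∃ j, i = j + 1 ∧ σ = r j) := fun h6 =>
      (S.room_of_door h hi (h6 ▸ hfσ)).resolve_left (Ne.symm hneq)
    rcases hi.lt_or_eq with hlt | rfl
    · obtain ⟨⟨h1, h2⟩, h3, h4, h5⟩ := h.2.2 i hlt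
      rcases S.other_door hdi h1 h2 hf with h6 | h6
      · exact Or.inl (hback h6)
      · rcases S.room_of_door h (k := i + 1) hlt (h6 ▸ hfσ) with h7 | ⟨j, hj, h7⟩
        · exact Or.inr ⟨hlt, h7⟩
        · obtain rfl : i = j := by omega
          exact absurd h7.symm hneq
    · rcases S.other_door hdi he hne hf with h6 | h6
      · exact Or.inl (hback h6)
      · subst h6
        exact absurd (S.exit_unique _ _ _ hex hf hfσ) hneq
  refine ⟨hinj, ?_, ?_⟩
  · intro i hi j hj
    constructor
    · intro hij
      rcases hnbr i hi _ hij with ⟨l, rfl, hl⟩ | ⟨hlt, hl⟩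
      · right
        rw [hinj hj (Set.mem_Iic.2 (by omega)) hl]
      · left
        rw [hinj hj (Set.mem_Iic.2 hlt) hl]
    · rintro (rfl | rfl)
      · exact hadj i hj
      · exact (hadj j hi).symm
  · intro σ
    constructor
    · rintro ⟨p⟩
      suffices H : ∀ a b, G.Walk a b → (∃ k ≤ m, r k = a) → ∃ k ≤ m, r k = b from
        H _ _ p ⟨0, Nat.zero_le m, rfl⟩
      intro a b p
      induction p with
      | nil => exact id
      | cons hab _ ih =>
        rintro ⟨k, hk, rfl⟩
        apply ih
        rcases hnbr k hk _ hab with ⟨l, rfl, hl⟩ | ⟨hlt, hl⟩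
        · exact ⟨l, by omega, hl.symm⟩
        · exact ⟨k + 1, hlt, hl.symm⟩
    · rintro ⟨k, hk, rfl⟩
      induction k with
      | zero => exact SimpleGraph.Reachable.refl _
      | succ k ih => exact (ih (by omega)).trans (hadj k hk).reachable

end DoorSystem

end Doors

/-! ### Combinatorics of the `K₁` triangulation -/

section Integer

variable {n : ℕ}

/-- The `j`-th vertex of the `K₁` simplex with smallest vertex `z` in which coordinate `a` is
raised in step `ρ a`. -/
def vert (z : Fin n → ℤ) (ρ : Equiv.Perm (Fin n)) (j : ℕ) : Fin n → ℤ :=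
  fun a => z a + if (ρ a : ℕ) < j then 1 else 0

/-- The vertex set of a `K₁` simplex, in integer coordinates. -/
def intSimplex (z : Fin n → ℤ) (ρ : Equiv.Perm (Fin n)) : Finset (Fin n → ℤ) :=
  (Finset.range (n + 1)).image (vert z ρ)

theorem mem_intSimplex {z : Fin n → ℤ} {ρ : Equiv.Perm (Fin n)} {v : Fin n → ℤ} :
    v ∈ intSimplex z ρ ↔ ∃ j ≤ n, vert z ρ j = v := by
  simp [intSimplex]

theorem vert_mem (z : Fin n → ℤ) (ρ : Equiv.Perm (Fin n)) {j : ℕ} (hj : j ≤ n) :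
    vert z ρ j ∈ intSimplex z ρ :=
  mem_intSimplex.2 ⟨j, hj, rfl⟩

theorem vert_zero (z : Fin n → ℤ) (ρ : Equiv.Perm (Fin n)) : vert z ρ 0 = z := by
  funext a
  simp [vert]

theorem vert_top (z : Fin n → ℤ) (ρ : Equiv.Perm (Fin n)) : vert z ρ n = z + 1 := by
  funext a
  simp [vert]

theorem vert_mono (z : Fin n → ℤ) (ρ : Equiv.Perm (Fin n)) : Monotone (vert z ρ) := by
  intro i j hij a
  change z a + _ ≤ z a + _
  split_ifs <;> omega

theorem sum_vert (z : Fin n → ℤ) (ρ : Equiv.Perm (Fin n)) {j : ℕ} (hj : j ≤ n) :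
    ∑ a, vert z ρ j a = ∑ a, z a + j := by
  have h : ∑ a, (if (ρ a : ℕ) < j then (1 : ℤ) else 0) = j := by
    rw [Equiv.sum_comp ρ (fun i : Fin n => if (i : ℕ) < j then (1 : ℤ) else 0)]
    rw [Fin.sum_univ_eq_sum_range (fun i => if i < j then (1 : ℤ) else 0) n, Finset.sum_boole]
    have : (Finset.range n).filter (· < j) = Finset.range j := by
      ext i
      simp only [Finset.mem_filter, Finset.mem_range]
      omega
    rw [this, Finset.card_range]
  simp only [vert, Finset.sum_add_distrib, h]

theorem vert_injOn (z : Fin n → ℤ) (ρ : Equiv.Perm (Fin n)) :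
    Set.InjOn (vert z ρ) (Set.Iic n) := by
  intro i hi j hj hij
  have h := congrArg (fun v => ∑ a, v a) hij
  simp only [sum_vert z ρ hi, sum_vert z ρ hj] at h
  exact_mod_cast add_left_cancel h

theorem card_intSimplex (z : Fin n → ℤ) (ρ : Equiv.Perm (Fin n)) :
    (intSimplex z ρ).card = n + 1 := by
  rw [intSimplex, Finset.card_image_of_injOn, Finset.card_range]
  refine (vert_injOn z ρ).mono fun i hi => ?_
  rw [Finset.coe_range, Set.mem_Iio] at hi
  exact Nat.lt_succ_iff.1 hi

/-- Two vertices of a common `K₁` simplex are comparable and differ by at most one. -/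
def Linked (u v : Fin n → ℤ) : Prop :=
  (u ≤ v ∨ v ≤ u) ∧ u ≤ v + 1 ∧ v ≤ u + 1

theorem linked_of_mem {z : Fin n → ℤ} {ρ : Equiv.Perm (Fin n)} {u v : Fin n → ℤ}
    (hu : u ∈ intSimplex z ρ) (hv : v ∈ intSimplex z ρ) : Linked u v := by
  obtain ⟨i, hi, rfl⟩ := mem_intSimplex.1 hu
  obtain ⟨j, hj, rfl⟩ := mem_intSimplex.1 hv
  refine ⟨(le_total i j).imp (fun h => vert_mono z ρ h) (fun h => vert_mono z ρ h), ?_, ?_⟩ <;>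
  · intro a
    simp only [vert, Pi.add_apply, Pi.one_apply]
    split_ifs <;> omega

theorem eq_of_le_of_sum_le {u v : Fin n → ℤ} (h : u ≤ v) (hs : ∑ a, v a ≤ ∑ a, u a) : u = v := by
  have := (Finset.sum_eq_sum_iff_of_le (fun a _ => h a)).1
    (le_antisymm (Finset.sum_le_sum fun a _ => h a) hs)
  exact funext fun a => this a (Finset.mem_univ a)

/-- A point linked to a vertex and of the same coordinate sum equals it. -/
theorem Linked.eq_of_sum {u v : Fin n → ℤ} (h : Linked u v) (hs : ∑ a, u a = ∑ a, v a) :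
    u = v := by
  rcases h.1 with h | h
  · exact eq_of_le_of_sum_le h hs.ge
  · exact (eq_of_le_of_sum_le h hs.le).symm

/-- A new point linked to all vertices of a facet has a coordinate sum different from theirs. -/
theorem sum_ne_of_linked {z : Fin n → ℤ} {ρ : Equiv.Perm (Fin n)} {i : ℕ} {v : Fin n → ℤ}
    (hv : ∀ j ≤ n, j ≠ i → Linked v (vert z ρ j) ∧ v ≠ vert z ρ j) {j : ℕ} (hj : j ≤ n)
    (hji : j ≠ i) : ∑ a, v a ≠ ∑ a, z a + j := by
  intro h
  exact (hv j hj hji).2 ((hv j hj hji).1.eq_of_sum (by rw [h, sum_vert z ρ hj]))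

/-- The point that replaces the smallest vertex is determined. -/
theorem replace_bottom {z : Fin n → ℤ} {ρ : Equiv.Perm (Fin n)} {v : Fin n → ℤ} (hn : 1 ≤ n)
    (hv : ∀ j ≤ n, j ≠ 0 → Linked v (vert z ρ j) ∧ v ≠ vert z ρ j) :
    v = vert z ρ 0 ∨ v = vert z ρ 1 + 1 := by
  have h1 := (hv 1 hn one_ne_zero).1.2.1
  have h2 : z ≤ v := by
    have := (hv n le_rfl (by omega)).1.2.2
    rw [vert_top] at this
    exact le_of_add_le_add_right this
  have hs1 : ∑ a, v a ≤ ∑ a, z a + (n + 1) := by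
    have := Finset.sum_le_sum (s := Finset.univ) fun a _ => h1 a
    simp only [Pi.add_apply, Finset.sum_add_distrib, sum_vert z ρ hn, Pi.one_apply,
      Finset.sum_const, Finset.card_univ, Fintype.card_fin, nsmul_eq_mul, mul_one] at this
    push_cast at this
    omega
  have hs2 : ∑ a, z a ≤ ∑ a, v a := Finset.sum_le_sum fun a _ => h2 a
  by_cases h0 : ∑ a, v a = ∑ a, z a
  · left
    rw [vert_zero]
    exact (eq_of_le_of_sum_le h2 h0.le).symm
  · right
    obtain ⟨j, hj⟩ : ∃ j : ℕ, ∑ a, v a = ∑ a, z a + j :=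
      ⟨(∑ a, v a - ∑ a, z a).toNat, by omega⟩
    by_cases hjn : j ≤ n
    · exact absurd hj (sum_ne_of_linked hv hjn (by rintro rfl; simp at hj; exact h0 hj))
    · refine eq_of_le_of_sum_le h1 ?_
      simp only [Pi.add_apply, Finset.sum_add_distrib, sum_vert z ρ hn, Pi.one_apply,
        Finset.sum_const, Finset.card_univ, Fintype.card_fin, nsmul_eq_mul, mul_one]
      push_cast
      omega

/-- The point that replaces the largest vertex is determined. -/
theorem replace_top {z : Fin (n + 1) → ℤ} {ρ : Equiv.Perm (Fin (n + 1))} {v : Fin (n + 1) → ℤ}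
    (hv : ∀ j ≤ n + 1, j ≠ n + 1 → Linked v (vert z ρ j) ∧ v ≠ vert z ρ j) :
    v = vert z ρ (n + 1) ∨ v = vert z ρ n - 1 := by
  have h1 : vert z ρ n - 1 ≤ v := sub_le_iff_le_add.2 (hv n (by omega) (by omega)).1.2.2
  have h2 : v ≤ z + 1 := by
    have := (hv 0 (by omega) (by omega)).1.2.1
    rwa [vert_zero] at this
  have e1 : ∑ a, (vert z ρ n - 1) a = ∑ a, z a - 1 := by
    simp only [Pi.sub_apply, Finset.sum_sub_distrib, sum_vert z ρ (Nat.le_succ n), Pi.one_apply,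
      Finset.sum_const, Finset.card_univ, Fintype.card_fin, nsmul_eq_mul, mul_one]
    push_cast
    ring
  have e2 : ∑ a, (z + 1) a = ∑ a, z a + (n + 1) := by
    simp [Finset.sum_add_distrib]
  have hs1 := Finset.sum_le_sum (s := Finset.univ) fun a _ => h1 a
  have hs2 := Finset.sum_le_sum (s := Finset.univ) fun a _ => h2 a
  rw [e1] at hs1
  rw [e2] at hs2
  by_cases h0 : ∑ a, v a = ∑ a, z a - 1
  · right
    exact (eq_of_le_of_sum_le h1 (by rw [e1, h0])).symm
  · left
    rw [vert_top]
    obtain ⟨j, hj⟩ : ∃ j : ℕ, ∑ a, v a = ∑ a, z a + j :=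
      ⟨(∑ a, v a - ∑ a, z a).toNat, by omega⟩
    by_cases hjn : j = n + 1
    · exact eq_of_le_of_sum_le h2 (by rw [e2, hj, hjn]; push_cast; exact le_rfl)
    · exact absurd hj (sum_ne_of_linked hv (by omega) hjn)

/-- Exchanging the steps `i` and `i + 1` changes only the vertex between them. -/
theorem vert_swap (z : Fin n → ℤ) (ρ : Equiv.Perm (Fin n)) {i j : ℕ} (hi : i + 1 < n)
    (hj : j ≠ i + 1) :
    vert z (ρ.trans (Equiv.swap ⟨i, by omega⟩ ⟨i + 1, hi⟩)) j = vert z ρ j := by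
  funext a
  unfold vert
  congr 1
  rw [Equiv.trans_apply, Equiv.swap_apply_def]
  split_ifs with h1 h2 h3 h4 h5 h6 h7 h8 h9 <;> simp_all <;> omega

/-- The point that replaces an inner vertex is determined. -/
theorem replace_inner {z : Fin n → ℤ} {ρ : Equiv.Perm (Fin n)} {v : Fin n → ℤ} {i : ℕ}
    (hi : i + 1 < n) (hv : ∀ j ≤ n, j ≠ i + 1 → Linked v (vert z ρ j) ∧ v ≠ vert z ρ j) :
    v = vert z ρ (i + 1) ∨
      v = vert z (ρ.trans (Equiv.swap ⟨i, by omega⟩ ⟨i + 1, hi⟩)) (i + 1) := by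
  set ρ' := ρ.trans (Equiv.swap ⟨i, by omega⟩ ⟨i + 1, hi⟩) with hρ'
  have h1 : v ≤ z + 1 := by
    have := (hv 0 (by omega) (by omega)).1.2.1
    rwa [vert_zero] at this
  have h2 : z ≤ v := by
    have := (hv n le_rfl (by omega)).1.2.2
    rw [vert_top] at this
    exact le_of_add_le_add_right this
  have e1 : ∑ a, (z + 1) a = ∑ a, z a + n := by
    simp [Finset.sum_add_distrib]
  have hs1 := Finset.sum_le_sum (s := Finset.univ) fun a _ => h1 a
  have hs2 := Finset.sum_le_sum (s := Finset.univ) fun a _ => h2 a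
  rw [e1] at hs1
  have hs : ∑ a, v a = ∑ a, z a + (i + 1) := by
    obtain ⟨j, hj⟩ : ∃ j : ℕ, ∑ a, v a = ∑ a, z a + j :=
      ⟨(∑ a, v a - ∑ a, z a).toNat, by omega⟩
    by_cases hji : j = i + 1
    · rw [hj, hji]
      push_cast
      rfl
    · exact absurd hj (sum_ne_of_linked hv (by omega) hji)
  have h3 : vert z ρ i ≤ v := by
    rcases (hv i (by omega) (by omega)).1.1 with h | h
    · have := Finset.sum_le_sum (s := Finset.univ) fun a _ => h a
      rw [sum_vert z ρ (by omega)] at this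
      omega
    · exact h
  have h4 : v ≤ vert z ρ (i + 2) := by
    rcases (hv (i + 2) (by omega) (by omega)).1.1 with h | h
    · exact h
    · have := Finset.sum_le_sum (s := Finset.univ) fun a _ => h a
      rw [sum_vert z ρ (by omega)] at this
      push_cast at this
      omega
  set a := ρ.symm ⟨i, by omega⟩ with ha
  have hρa : ρ a = ⟨i, by omega⟩ := by rw [ha, Equiv.apply_symm_apply]
  have hval : ∀ b, (ρ b : ℕ) = i → b = a := by
    intro b hb
    rw [ha, Equiv.eq_symm_apply]
    exact Fin.ext hb
  by_cases hva : v a = z a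
  · right
    refine eq_of_le_of_sum_le ?_ ?_
    · intro b
      have h5 := h4 b
      have h6 := h1 b
      simp only [vert, Pi.add_apply, Pi.one_apply, hρ', Equiv.trans_apply] at h5 h6 ⊢
      rw [Equiv.swap_apply_def]
      by_cases hb : b = a
      · subst hb
        split_ifs <;> omega
      · have h7 : (ρ b : ℕ) ≠ i := fun h => hb (hval b h)
        have h8 : ρ b ≠ ⟨i, by omega⟩ := fun h => h7 (by rw [h])
        rw [if_neg h8]
        by_cases h9 : ρ b = ⟨i + 1, hi⟩
        · rw [if_pos h9]
          simpa using h6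
        · have h10 : (ρ b : ℕ) ≠ i + 1 := fun h => h9 (Fin.ext h)
          rw [if_neg h9]
          split_ifs at h5 ⊢ <;> omega
    · rw [sum_vert z ρ' (by omega), hs]
      push_cast
      exact le_rfl
  · left
    symm
    refine eq_of_le_of_sum_le ?_ ?_
    · intro b
      have h5 := h3 b
      have h6 := h2 b
      simp only [vert] at h5 ⊢
      by_cases hb : b = a
      · subst hb
        split_ifs <;> omega
      · have h7 : (ρ b : ℕ) ≠ i := fun h => hb (hval b h)
        split_ifs at h5 ⊢ <;> omega
    · rw [sum_vert z ρ (by omega), hs]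
      push_cast
      exact le_rfl

theorem coe_finRotate_symm (x : Fin (n + 1)) :
    (((finRotate (n + 1)).symm x : Fin (n + 1)) : ℕ) = if (x : ℕ) = 0 then n else (x : ℕ) - 1 := by
  obtain ⟨y, rfl⟩ := (finRotate (n + 1)).surjective x
  rw [Equiv.symm_apply_apply]
  by_cases hy : y = Fin.last n
  · subst hy
    simp
  · rw [coe_finRotate_of_ne_last hy]
    simp

theorem coe_finRotate' (x : Fin (n + 1)) :
    ((finRotate (n + 1) x : Fin (n + 1)) : ℕ) = if (x : ℕ) = n then 0 else (x : ℕ) + 1 := by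
  by_cases hx : x = Fin.last n
  · subst hx
    simp
  · rw [coe_finRotate_of_ne_last hx, if_neg fun h : (x : ℕ) = n => hx (Fin.ext h)]

/-- Dropping the smallest vertex and appending a new largest one. -/
theorem vert_shift_up (z : Fin (n + 1) → ℤ) (ρ : Equiv.Perm (Fin (n + 1))) {j : ℕ} (hj : j ≤ n) :
    vert (vert z ρ 1) (ρ.trans (finRotate (n + 1)).symm) j = vert z ρ (j + 1) := by
  funext a
  simp only [vert, Equiv.trans_apply, coe_finRotate_symm]
  have := (ρ a).2
  split_ifs <;> omega

/-- Dropping the largest vertex and prepending a new smallest one. -/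
theorem vert_shift_down (z : Fin (n + 1) → ℤ) (ρ : Equiv.Perm (Fin (n + 1))) {j : ℕ} (hj : j ≤ n) :
    vert (vert z ρ n - 1) (ρ.trans (finRotate (n + 1))) (j + 1) = vert z ρ j := by
  funext a
  simp only [vert, Equiv.trans_apply, coe_finRotate', Pi.sub_apply, Pi.one_apply]
  have := (ρ a).2
  split_ifs <;> omega

/-- The point replacing the `i`-th vertex in the neighbour of a `K₁` simplex across the facet
opposite this vertex. -/
def oppVert (z : Fin (n + 1) → ℤ) (ρ : Equiv.Perm (Fin (n + 1))) (i : ℕ) : Fin (n + 1) → ℤ :=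
  if h : i - 1 + 1 < n + 1 then
    if i = 0 then vert z ρ 1 + 1
    else vert z (ρ.trans (Equiv.swap ⟨i - 1, by omega⟩ ⟨i - 1 + 1, h⟩)) i
  else if i = 0 then vert z ρ 1 + 1 else vert z ρ n - 1

theorem eq_or_eq_oppVert {z : Fin (n + 1) → ℤ} {ρ : Equiv.Perm (Fin (n + 1))} {i : ℕ}
    (hi : i ≤ n + 1) {v : Fin (n + 1) → ℤ}
    (hv : ∀ j ≤ n + 1, j ≠ i → Linked v (vert z ρ j) ∧ v ≠ vert z ρ j) :
    v = vert z ρ i ∨ v = oppVert z ρ i := by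
  unfold oppVert
  rcases Nat.eq_zero_or_pos i with rfl | hpos
  · simp only [if_true, dite_eq_ite, ite_self]
    exact replace_bottom (by omega) hv
  · obtain ⟨i, rfl⟩ : ∃ i', i = i' + 1 := ⟨i - 1, by omega⟩
    by_cases h : i + 1 < n + 1
    · simp only [Nat.add_sub_cancel, h, dif_pos, Nat.succ_ne_zero, if_false]
      exact replace_inner h hv
    · obtain rfl : i = n := by omega
      simp only [Nat.add_sub_cancel, lt_irrefl, dif_neg, Nat.succ_ne_zero, if_false,
        not_false_eq_true]
      exact replace_top hv

/-- At most one other `K₁` simplex shares a facet with a given one. -/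
theorem eq_or_eq_insert_oppVert {z z' : Fin (n + 1) → ℤ} {ρ ρ' : Equiv.Perm (Fin (n + 1))} {i : ℕ}
    (hi : i ≤ n + 1) (hsub : (intSimplex z ρ).erase (vert z ρ i) ⊆ intSimplex z' ρ') :
    intSimplex z' ρ' = intSimplex z ρ ∨
      intSimplex z' ρ' = insert (oppVert z ρ i) ((intSimplex z ρ).erase (vert z ρ i)) := by
  set τ := (intSimplex z ρ).erase (vert z ρ i) with hτ
  have hmem := vert_mem z ρ hi
  have hcard : τ.card = n + 1 := by
    rw [hτ, Finset.card_erase_of_mem hmem, card_intSimplex]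
    rfl
  obtain ⟨v, hvτ, hv⟩ := (Finset.exists_eq_insert_iff.2
    ⟨hsub, by rw [hcard, card_intSimplex]⟩ : ∃ a, a ∉ τ ∧ insert a τ = intSimplex z' ρ')
  have hmemτ : ∀ j ≤ n + 1, j ≠ i → vert z ρ j ∈ τ := fun j hj hji =>
    Finset.mem_erase.2 ⟨fun h => hji (vert_injOn z ρ hj hi h), vert_mem z ρ hj⟩
  rcases eq_or_eq_oppVert hi (v := v) (z := z) (ρ := ρ) (fun j hj hji => by
    refine ⟨linked_of_mem (z := z') (ρ := ρ') ?_ (hsub (hmemτ j hj hji)), ?_⟩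
    · rw [← hv]
      exact Finset.mem_insert_self _ _
    · rintro rfl
      exact hvτ (hmemτ j hj hji)) with h | h
  · left
    rw [← hv, h, hτ, Finset.insert_erase hmem]
  · right
    rw [← hv, h]

end Integer

section Strip

variable {N : ℕ}

/-- Across a facet that is not contained in the boundary of the strip there is another simplex of
the strip. -/
theorem exists_neighbour {z : Fin (N + 1) → ℤ} {ρ : Equiv.Perm (Fin (N + 1))}
    (hz : z (Fin.last N) = 0) {i : ℕ} (hi : i ≤ N + 1)
    (h0 : ¬ ∀ y ∈ (intSimplex z ρ).erase (vert z ρ i), y (Fin.last N) = 0)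
    (h1 : ¬ ∀ y ∈ (intSimplex z ρ).erase (vert z ρ i), y (Fin.last N) = 1) :
    ∃ z' ρ', z' (Fin.last N) = 0 ∧
      (intSimplex z ρ).erase (vert z ρ i) ⊆ intSimplex z' ρ' ∧ intSimplex z' ρ' ≠ intSimplex z ρ := by
  have hforall : ∀ P : (Fin (N + 1) → ℤ) → Prop, (∀ j ≤ N + 1, j ≠ i → P (vert z ρ j)) →
      ∀ y ∈ (intSimplex z ρ).erase (vert z ρ i), P y := by
    intro P hP y hy
    obtain ⟨hne, hy⟩ := Finset.mem_erase.1 hy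
    obtain ⟨j, hj, rfl⟩ := mem_intSimplex.1 hy
    exact hP j hj fun h => hne (by rw [h])
  have hsub : ∀ z' ρ', (∀ j ≤ N + 1, j ≠ i → vert z ρ j ∈ intSimplex z' ρ') →
      (intSimplex z ρ).erase (vert z ρ i) ⊆ intSimplex z' ρ' := fun z' ρ' h y hy =>
    hforall (· ∈ intSimplex z' ρ') h y hy
  rcases Nat.eq_zero_or_pos i with rfl | hpos
  · refine ⟨vert z ρ 1, ρ.trans (finRotate (N + 1)).symm, ?_, hsub _ _ ?_, ?_⟩
    · by_contra hne
      refine h1 (hforall _ fun j hj hj0 => ?_)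
      simp only [vert, hz] at hne ⊢
      split_ifs at hne ⊢ <;> omega
    · intro j hj hj0
      obtain ⟨j, rfl⟩ : ∃ j', j = j' + 1 := ⟨j - 1, by omega⟩
      rw [← vert_shift_up z ρ (Nat.le_of_succ_le_succ hj)]
      exact vert_mem _ _ (by omega)
    · intro heq
      have hm := vert_mem (vert z ρ 1) (ρ.trans (finRotate (N + 1)).symm) le_rfl
      rw [heq] at hm
      obtain ⟨j, hj, hj'⟩ := mem_intSimplex.1 hm
      have := congrArg (fun v => ∑ a, v a) hj'
      simp only [sum_vert _ _ hj, sum_vert _ _ le_rfl, sum_vert z ρ (show 1 ≤ N + 1 by omega)]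
        at this
      push_cast at this
      omega
  · obtain ⟨i, rfl⟩ : ∃ i', i = i' + 1 := ⟨i - 1, by omega⟩
    by_cases h : i + 1 < N + 1
    · refine ⟨z, ρ.trans (Equiv.swap ⟨i, by omega⟩ ⟨i + 1, h⟩), hz, hsub _ _ ?_, ?_⟩
      · intro j hj hji
        rw [← vert_swap z ρ h hji]
        exact vert_mem _ _ hj
      · intro heq
        have hm := vert_mem z (ρ.trans (Equiv.swap ⟨i, by omega⟩ ⟨i + 1, h⟩)) hi
        rw [heq] at hm
        obtain ⟨j, hj, hj'⟩ := mem_intSimplex.1 hm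
        have hsum := congrArg (fun v => ∑ a, v a) hj'
        simp only [sum_vert _ _ hj, sum_vert _ _ hi] at hsum
        obtain rfl : j = i + 1 := by omega
        have := congrFun hj' (ρ.symm ⟨i, by omega⟩)
        simp [vert] at this
    · obtain rfl : i = N := by omega
      refine ⟨vert z ρ i - 1, ρ.trans (finRotate (i + 1)), ?_, hsub _ _ ?_, ?_⟩
      · by_contra hne
        refine h0 (hforall _ fun j hj hj0 => ?_)
        simp only [vert, hz, Pi.sub_apply, Pi.one_apply] at hne ⊢
        split_ifs at hne ⊢ <;> omega
      · intro j hj hj0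
        rw [← vert_shift_down z ρ (j := j) (by omega)]
        exact vert_mem _ _ (by omega)
      · intro heq
        have hm := vert_mem (vert z ρ i - 1) (ρ.trans (finRotate (i + 1))) (Nat.zero_le _)
        rw [heq, vert_zero] at hm
        obtain ⟨j, hj, hj'⟩ := mem_intSimplex.1 hm
        have := congrArg (fun v => ∑ a, v a) hj'
        simp only [sum_vert _ _ hj, Pi.sub_apply, Pi.one_apply, Finset.sum_sub_distrib,
          sum_vert z ρ (show i ≤ i + 1 by omega), Finset.sum_const, Finset.card_univ,
          Fintype.card_fin, nsmul_eq_mul, mul_one] at this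
        push_cast at this
        omega

/-- A facet in the upper boundary of the strip belongs to a single simplex of the strip. -/
theorem strip_unique_of_upper {z z' : Fin (N + 1) → ℤ} {ρ ρ' : Equiv.Perm (Fin (N + 1))}
    (hz : z (Fin.last N) = 0) (hz' : z' (Fin.last N) = 0) {i : ℕ} (hi : i ≤ N + 1)
    (h1 : ∀ y ∈ (intSimplex z ρ).erase (vert z ρ i), y (Fin.last N) = 1)
    (hsub : (intSimplex z ρ).erase (vert z ρ i) ⊆ intSimplex z' ρ') :
    intSimplex z' ρ' = intSimplex z ρ := by
  have hmemτ : ∀ j ≤ N + 1, j ≠ i → vert z ρ j ∈ (intSimplex z ρ).erase (vert z ρ i) :=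
    fun j hj hji =>
      Finset.mem_erase.2 ⟨fun h => hji (vert_injOn z ρ hj hi h), vert_mem z ρ hj⟩
  obtain rfl : i = 0 := by
    by_contra hne
    have := h1 _ (hmemτ 0 (by omega) (Ne.symm hne))
    rw [vert_zero, hz] at this
    omega
  have h2 := h1 _ (hmemτ 1 (by omega) one_ne_zero)
  rcases eq_or_eq_insert_oppVert hi hsub with h | h
  · exact h
  · exfalso
    have hm : oppVert z ρ 0 ∈ intSimplex z' ρ' := by
      rw [h]
      exact Finset.mem_insert_self _ _
    obtain ⟨j, hj, hj'⟩ := mem_intSimplex.1 hm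
    have := congrFun hj' (Fin.last N)
    simp only [oppVert, if_true, dite_eq_ite, ite_self, Pi.add_apply, h2, Pi.one_apply] at this
    simp only [vert, hz'] at this
    split_ifs at this <;> omega

/-- Integer coordinates of the scaled triangulation: the first `N` coordinates are multiplied by
`δ`. -/
def gridPoint (δ : ℝ) (v : Fin (N + 1) → ℤ) : Fin (N + 1) → ℝ :=
  fun a => if a = Fin.last N then (v a : ℝ) else δ * v a

theorem gridPoint_last (δ : ℝ) (v : Fin (N + 1) → ℤ) :
    gridPoint δ v (Fin.last N) = v (Fin.last N) := by
  simp [gridPoint]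

theorem proj_gridPoint (δ : ℝ) (v : Fin (N + 1) → ℤ) (a : Fin N) :
    proj (gridPoint δ v) a = δ * v a.castSucc := by
  simp [gridPoint, proj, (Fin.castSucc_lt_last a).ne]

theorem gridPoint_injective {δ : ℝ} (hδ : 0 < δ) :
    Function.Injective (gridPoint δ : (Fin (N + 1) → ℤ) → _) := by
  intro u v h
  funext a
  have := congrFun h a
  unfold gridPoint at this
  split_ifs at this
  · exact_mod_cast this
  · exact_mod_cast mul_left_cancel₀ hδ.ne' this

theorem mem_K1_iff {n : ℕ} {η : Finset (Fin n → ℝ)} :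
    η ∈ K1 n ↔ ∃ z ρ, η = (intSimplex z ρ).image fun v a => (v a : ℝ) := by
  have hvert : ∀ (z : Fin n → ℤ) (π : Equiv.Perm (Fin n)) (i : Fin n),
      (fun a => (vert z π.symm (i + 1) a : ℝ)) =
        (fun a => (vert z π.symm i a : ℝ)) + Pi.single (π i) 1 := by
    intro z π i
    funext a
    simp only [vert, Pi.add_apply, Pi.single_apply]
    by_cases ha : a = π i
    · simp [ha]
    · have : ((π.symm a : Fin n) : ℕ) ≠ i := by
        intro h
        exact ha (by rw [← Equiv.symm_apply_eq]; exact Fin.ext h)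
      have h' : ((π.symm a : Fin n) : ℕ) < i + 1 ↔ ((π.symm a : Fin n) : ℕ) < i := by omega
      simp [ha, h']
  have himage : ∀ (z : Fin n → ℤ) (ρ : Equiv.Perm (Fin n)),
      (Finset.univ.image fun (i : Fin (n + 1)) (a : Fin n) => (vert z ρ i a : ℝ)) =
        (intSimplex z ρ).image fun v a => (v a : ℝ) := by
    intro z ρ
    ext y
    simp only [Finset.mem_image, Finset.mem_univ, true_and, mem_intSimplex]
    constructor
    · rintro ⟨i, rfl⟩
      exact ⟨_, ⟨i, Nat.lt_succ_iff.1 i.2, rfl⟩, rfl⟩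
    · rintro ⟨_, ⟨j, hj, rfl⟩, rfl⟩
      exact ⟨⟨j, Nat.lt_succ_iff.2 hj⟩, rfl⟩
  constructor
  · rintro ⟨x, π, ⟨z, hz⟩, hx, rfl⟩
    refine ⟨z, π.symm, ?_⟩
    rw [← himage]
    have : x = fun (i : Fin (n + 1)) (a : Fin n) => (vert z π.symm i a : ℝ) := by
      funext i
      induction i using Fin.induction with
      | zero =>
        funext a
        rw [hz]
        simp [vert]
      | succ i ih =>
        rw [hx, ih]
        exact (hvert z π i).symm
    rw [this]
  · rintro ⟨z, ρ, rfl⟩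
    refine ⟨fun i a => (vert z ρ i a : ℝ), ρ.symm, ⟨z, fun j => by simp [vert]⟩, fun i => ?_,
      (himage z ρ).symm⟩
    have := hvert z ρ.symm i
    simpa using this

theorem mem_K1Tilde_iff {δ : ℝ} {η : Finset (Fin (N + 1) → ℝ)} :
    η ∈ K1Tilde N δ ↔
      ∃ z ρ, z (Fin.last N) = 0 ∧ η = (intSimplex z ρ).image (gridPoint δ) := by
  have hcomp : (scaleP δ ∘ fun (v : Fin (N + 1) → ℤ) a => (v a : ℝ)) = gridPoint δ := by
    funext v a
    simp only [scaleP, gridPoint, Function.comp_apply]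
  constructor
  · rintro ⟨σ, ⟨hσ, hstrip⟩, rfl⟩
    obtain ⟨z, ρ, rfl⟩ := mem_K1_iff.1 hσ
    refine ⟨z, ρ, ?_, by rw [Finset.image_image, hcomp]⟩
    have h0 := hstrip _ (Finset.mem_image_of_mem _ (vert_mem z ρ (Nat.zero_le _)))
    have h1 := hstrip _ (Finset.mem_image_of_mem _ (vert_mem z ρ le_rfl))
    rw [vert_zero] at h0
    rw [vert_top] at h1
    have h2 : (0 : ℤ) ≤ z (Fin.last N) := by exact_mod_cast h0.1
    have h3 : z (Fin.last N) + 1 ≤ 1 := by exact_mod_cast h1.2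
    omega
  · rintro ⟨z, ρ, hz, rfl⟩
    refine ⟨_, ⟨mem_K1_iff.2 ⟨z, ρ, rfl⟩, ?_⟩, by rw [Finset.image_image, hcomp]⟩
    intro y hy
    obtain ⟨v, hv, rfl⟩ := Finset.mem_image.1 hy
    obtain ⟨j, hj, rfl⟩ := mem_intSimplex.1 hv
    simp only [vert, hz]
    split_ifs <;> norm_num

variable {δ : ℝ} {η η' τ : Finset (Fin (N + 1) → ℝ)}

theorem card_of_mem_K1Tilde (hδ : 0 < δ) (hη : η ∈ K1Tilde N δ) : η.card = N + 2 := by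
  obtain ⟨z, ρ, _, rfl⟩ := mem_K1Tilde_iff.1 hη
  rw [Finset.card_image_of_injective _ (gridPoint_injective hδ), card_intSimplex]

/-- The facets of a simplex are opposite to its vertices. -/
theorem exists_facet_eq (hδ : 0 < δ) {z : Fin (N + 1) → ℤ} {ρ : Equiv.Perm (Fin (N + 1))}
    (hτ : τ ⊆ (intSimplex z ρ).image (gridPoint δ)) (hcard : τ.card = N + 1) :
    ∃ i ≤ N + 1, τ = ((intSimplex z ρ).erase (vert z ρ i)).image (gridPoint δ) := by
  obtain ⟨σ, hσ, rfl⟩ := Finset.subset_image_iff.1 hτ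
  rw [Finset.card_image_of_injective _ (gridPoint_injective hδ)] at hcard
  obtain ⟨v, hv, hvσ⟩ := Finset.exists_eq_insert_iff.2
    ⟨hσ, by rw [hcard, card_intSimplex]⟩
  have hvm : v ∈ intSimplex z ρ := by
    rw [← hvσ]
    exact Finset.mem_insert_self _ _
  obtain ⟨i, hi, rfl⟩ := mem_intSimplex.1 hvm
  exact ⟨i, hi, by rw [← hvσ, Finset.erase_insert hv]⟩

theorem onLevel_image_iff {σ : Finset (Fin (N + 1) → ℤ)} {t : ℤ} :
    OnLevel t (σ.image (gridPoint δ)) ↔ ∀ y ∈ σ, y (Fin.last N) = t := by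
  unfold OnLevel
  rw [Finset.forall_mem_image]
  simp only [gridPoint_last, Int.cast_inj]

/-- A facet not in the boundary of the strip belongs to exactly two simplices. -/
theorem exists_other_simplex (hδ : 0 < δ) (hη : η ∈ K1Tilde N δ) (hτ : τ ⊆ η)
    (hcard : τ.card = N + 1) (h0 : ¬ OnLevel 0 τ) (h1 : ¬ OnLevel 1 τ) :
    ∃ η' ∈ K1Tilde N δ, τ ⊆ η' ∧ η' ≠ η ∧ ∀ η'' ∈ K1Tilde N δ, τ ⊆ η'' → η'' = η ∨ η'' = η' := by
  obtain ⟨z, ρ, hz, rfl⟩ := mem_K1Tilde_iff.1 hη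
  obtain ⟨i, hi, rfl⟩ := exists_facet_eq hδ hτ hcard
  have hinj := gridPoint_injective (N := N) hδ
  have h0' := h0
  have h1' := h1
  rw [← Int.cast_zero, onLevel_image_iff] at h0'
  rw [← Int.cast_one, onLevel_image_iff] at h1'
  obtain ⟨z', ρ', hz', hsub, hne⟩ := exists_neighbour hz hi h0' h1'
  refine ⟨_, mem_K1Tilde_iff.2 ⟨z', ρ', hz', rfl⟩, Finset.image_subset_image hsub,
    fun h => hne (Finset.image_injective hinj h), ?_⟩
  intro η'' hη'' hsub''
  obtain ⟨z'', ρ'', hz'', rfl⟩ := mem_K1Tilde_iff.1 hη''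
  have hsub'' := (Finset.image_subset_image_iff hinj).1 hsub''
  have e1 := (eq_or_eq_insert_oppVert hi hsub).resolve_left hne
  rcases eq_or_eq_insert_oppVert hi hsub'' with h | h
  · exact Or.inl (by rw [h])
  · exact Or.inr (by rw [h, e1])

theorem eq_of_onLevel_one (hδ : 0 < δ) (hη : η ∈ K1Tilde N δ) (hη' : η' ∈ K1Tilde N δ)
    (hτ : τ ⊆ η) (hτ' : τ ⊆ η') (hcard : τ.card = N + 1) (h1 : OnLevel 1 τ) : η = η' := by
  obtain ⟨z, ρ, hz, rfl⟩ := mem_K1Tilde_iff.1 hη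
  obtain ⟨z', ρ', hz', rfl⟩ := mem_K1Tilde_iff.1 hη'
  obtain ⟨i, hi, rfl⟩ := exists_facet_eq hδ hτ hcard
  rw [← Int.cast_one, onLevel_image_iff] at h1
  rw [strip_unique_of_upper hz hz' hi h1
    ((Finset.image_subset_image_iff (gridPoint_injective hδ)).1 hτ')]

theorem last_eq_zero_or_one (hη : η ∈ K1Tilde N δ) {y : Fin (N + 1) → ℝ} (hy : y ∈ η) :
    y (Fin.last N) = 0 ∨ y (Fin.last N) = 1 := by
  obtain ⟨z, ρ, hz, rfl⟩ := mem_K1Tilde_iff.1 hη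
  obtain ⟨v, hv, rfl⟩ := Finset.mem_image.1 hy
  obtain ⟨j, hj, rfl⟩ := mem_intSimplex.1 hv
  rw [gridPoint_last]
  simp only [vert, hz]
  split_ifs <;> norm_num

theorem abs_proj_sub_le (hδ : 0 < δ) (hη : η ∈ K1Tilde N δ) {y y' : Fin (N + 1) → ℝ} (hy : y ∈ η)
    (hy' : y' ∈ η) (a : Fin N) : |proj y a - proj y' a| ≤ δ := by
  obtain ⟨z, ρ, hz, rfl⟩ := mem_K1Tilde_iff.1 hη
  obtain ⟨u, hu, rfl⟩ := Finset.mem_image.1 hy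
  obtain ⟨v, hv, rfl⟩ := Finset.mem_image.1 hy'
  have h := linked_of_mem hu hv
  have h1 : (u a.castSucc : ℝ) ≤ v a.castSucc + 1 := by exact_mod_cast h.2.1 a.castSucc
  have h2 : (v a.castSucc : ℝ) ≤ u a.castSucc + 1 := by exact_mod_cast h.2.2 a.castSucc
  rw [proj_gridPoint, proj_gridPoint, ← mul_sub, abs_mul, abs_of_pos hδ]
  have : |(u a.castSucc : ℝ) - v a.castSucc| ≤ 1 := abs_le.2 ⟨by linarith, by linarith⟩
  nlinarith

/-- A simplex with a facet in the orthant but not in one of its coordinate hyperplanes lies in the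
orthant. -/
theorem inOrthant_of_facet (hδ : 0 < δ) (hη : η ∈ K1Tilde N δ) (hτ : τ ⊆ η) (h : InOrthant τ)
    (hne : ∀ a : Fin N, ∃ y ∈ τ, proj y a ≠ 0) : InOrthant η := by
  intro y hy a
  by_contra hlt
  rw [Pi.zero_apply, not_le] at hlt
  obtain ⟨z, ρ, hz, rfl⟩ := mem_K1Tilde_iff.1 hη
  obtain ⟨u, hu, rfl⟩ := Finset.mem_image.1 hy
  obtain ⟨y', hy', hne'⟩ := hne a
  obtain ⟨v, hv, rfl⟩ := Finset.mem_image.1 (hτ hy')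
  have h0 := h _ hy' a
  rw [Pi.zero_apply, proj_gridPoint] at h0
  rw [proj_gridPoint] at hlt hne'
  have hu0 : u a.castSucc < 0 := by
    by_contra hge
    push Not at hge
    have : (0 : ℝ) ≤ u a.castSucc := by exact_mod_cast hge
    exact absurd hlt (not_lt.2 (mul_nonneg hδ.le this))
  have hv0 : 0 < v a.castSucc := by
    have h1 : (0 : ℝ) < δ * v a.castSucc := lt_of_le_of_ne h0 hne'.symm
    exact_mod_cast (mul_pos_iff_of_pos_left hδ).1 h1
  have := (linked_of_mem hv hu).2.1 a.castSucc
  simp only [Pi.add_apply, Pi.one_apply] at this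
  omega

/-- Only finitely many simplices of the triangulation lie in a bounded part of the orthant. -/
theorem finite_bounded_simplices (hδ : 0 < δ) (M : ℝ) :
    {η | η ∈ K1Tilde N δ ∧ InOrthant η ∧ ∀ y ∈ η, ∀ a, proj y a ≤ M}.Finite := by
  obtain ⟨K, hK⟩ := exists_nat_ge (M / δ)
  set S : Finset (Fin (N + 1) → ℤ) := Finset.Icc 0 (fun _ => (K : ℤ) + 1) with hS
  refine ((S.image (gridPoint δ)).powerset.finite_toSet).subset ?_
  rintro η ⟨hη, horth, hb⟩
  rw [Finset.mem_coe, Finset.mem_powerset]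
  obtain ⟨z, ρ, hz, rfl⟩ := mem_K1Tilde_iff.1 hη
  refine Finset.image_subset_image fun v hv => ?_
  have hmem := Finset.mem_image_of_mem (gridPoint δ) hv
  have hcoord : ∀ a, 0 ≤ v a ∧ v a ≤ (K : ℤ) + 1 := by
    intro a
    refine Fin.lastCases ?_ (fun a => ?_) a
    · have := last_eq_zero_or_one hη hmem
      rw [gridPoint_last] at this
      have h : v (Fin.last N) = 0 ∨ v (Fin.last N) = 1 := by exact_mod_cast this
      omega
    · have h0 := horth _ hmem a
      have h1 := hb _ hmem a
      rw [Pi.zero_apply, proj_gridPoint] at h0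
      rw [proj_gridPoint] at h1
      have h2 : (0 : ℝ) ≤ v a.castSucc := (mul_nonneg_iff_of_pos_left hδ).1 h0
      have h3 : (v a.castSucc : ℝ) ≤ M / δ := by
        rw [le_div_iff₀ hδ]
        linarith
      have h4 : (v a.castSucc : ℝ) ≤ K := h3.trans hK
      have h5 : v a.castSucc ≤ (K : ℤ) := by exact_mod_cast h4
      exact ⟨by exact_mod_cast h2, by omega⟩
  rw [hS, Finset.mem_Icc]
  exact ⟨fun a => (hcoord a).1, fun a => (hcoord a).2⟩

end Strip

/-! ### The starting simplex -/

section Start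

variable {N : ℕ} {δ : ℝ}

/-- A facet in the lower boundary is opposite the largest vertex, and the last coordinate is the last
one to be raised. -/
theorem facet_lower {z : Fin (N + 1) → ℤ} {ρ : Equiv.Perm (Fin (N + 1))}
    (hz : z (Fin.last N) = 0) {i : ℕ} (hi : i ≤ N + 1)
    (h0 : ∀ y ∈ (intSimplex z ρ).erase (vert z ρ i), y (Fin.last N) = 0) :
    i = N + 1 ∧ ρ (Fin.last N) = Fin.last N := by
  have hmemτ : ∀ j ≤ N + 1, j ≠ i → vert z ρ j (Fin.last N) = 0 :=
    fun j hj hji => h0 _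
      (Finset.mem_erase.2 ⟨fun h => hji (vert_injOn z ρ hj hi h), vert_mem z ρ hj⟩)
  have h1 : i = N + 1 := by
    by_contra hne
    have := hmemτ (N + 1) le_rfl (Ne.symm hne)
    rw [vert_top, Pi.add_apply, hz] at this
    simp at this
  refine ⟨h1, ?_⟩
  have h2 := hmemτ N (by omega) (by omega)
  simp only [vert, hz] at h2
  apply Fin.ext
  have := (ρ (Fin.last N)).2
  rw [Fin.val_last]
  split_ifs at h2 <;> omega

/-- The inequalities describing a closed `K₁` simplex: the fractional parts of the coordinates are
ordered by the permutation. -/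
theorem convexHull_subset {z : Fin (N + 1) → ℤ} {ρ : Equiv.Perm (Fin (N + 1))} (hδ : 0 < δ)
    {T : Set (Fin (N + 1) → ℝ)} (hT : T ⊆ gridPoint δ '' (intSimplex z ρ : Set _)) :
    convexHull ℝ (proj '' T) ⊆
      {u : Fin N → ℝ | (∀ a : Fin N, δ * z a.castSucc ≤ u a ∧ u a ≤ δ * (z a.castSucc + 1)) ∧
        ∀ a b : Fin N, ρ a.castSucc < ρ b.castSucc →
          u b - δ * z b.castSucc ≤ u a - δ * z a.castSucc} := by
  apply convexHull_min
  · rintro _ ⟨y, hy, rfl⟩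
    obtain ⟨v, hv, rfl⟩ := hT hy
    obtain ⟨j, hj, rfl⟩ := mem_intSimplex.1 (Finset.mem_coe.1 hv)
    refine ⟨fun a => ?_, fun a b hab => ?_⟩
    · rw [proj_gridPoint]
      simp only [vert]
      split_ifs
      · push_cast
        exact ⟨by nlinarith, le_rfl⟩
      · push_cast
        exact ⟨by nlinarith, by nlinarith⟩
    · rw [proj_gridPoint, proj_gridPoint]
      simp only [vert]
      have hab' : (ρ a.castSucc : ℕ) < ρ b.castSucc := hab
      split_ifs
      · push_cast
        nlinarith
      · omega
      · push_cast
        nlinarith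
      · push_cast
        nlinarith
  · rintro x ⟨hx1, hx2⟩ y ⟨hy1, hy2⟩ s t hs ht hst
    obtain rfl : t = 1 - s := by linarith
    refine ⟨fun a => ?_, fun a b hab => ?_⟩
    · have h1 := hx1 a
      have h2 := hy1 a
      simp only [Pi.add_apply, Pi.smul_apply, smul_eq_mul]
      constructor
      · nlinarith [mul_le_mul_of_nonneg_left h1.1 hs, mul_le_mul_of_nonneg_left h2.1 ht]
      · nlinarith [mul_le_mul_of_nonneg_left h1.2 hs, mul_le_mul_of_nonneg_left h2.2 ht]
    · simp only [Pi.add_apply, Pi.smul_apply, smul_eq_mul]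
      nlinarith [mul_le_mul_of_nonneg_left (hx2 a b hab) hs,
        mul_le_mul_of_nonneg_left (hy2 a b hab) ht]

/-- In the interior the inequalities describing a `K₁` simplex are strict. -/
theorem interior_convexHull_subset {z : Fin (N + 1) → ℤ} {ρ : Equiv.Perm (Fin (N + 1))}
    (hδ : 0 < δ) {T : Set (Fin (N + 1) → ℝ)} (hT : T ⊆ gridPoint δ '' (intSimplex z ρ : Set _))
    {c : Fin N → ℝ} (hc : c ∈ interior (convexHull ℝ (proj '' T))) :
    (∀ a : Fin N, δ * z a.castSucc < c a ∧ c a < δ * (z a.castSucc + 1)) ∧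
      ∀ a b : Fin N, ρ a.castSucc < ρ b.castSucc →
        c b - δ * z b.castSucc < c a - δ * z a.castSucc := by
  obtain ⟨ε, hε, hball⟩ := Metric.isOpen_iff.1 isOpen_interior c hc
  have hmem : ∀ (a : Fin N) (s : ℝ), |s| < ε → c + Pi.single a s ∈
      convexHull ℝ (proj '' T) := by
    intro a s hs
    refine interior_subset (hball ?_)
    rw [Metric.mem_ball, dist_self_add_left, Pi.norm_single]
    exact hs
  have h1 : |ε / 2| < ε := by rw [abs_of_pos (by linarith)]; linarith
  have h2 : |-(ε / 2)| < ε := by rwa [abs_neg]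
  refine ⟨fun a => ⟨?_, ?_⟩, fun a b hab => ?_⟩
  · have := ((convexHull_subset hδ hT (hmem a _ h2)).1 a).1
    simp only [Pi.add_apply, Pi.single_eq_same] at this
    linarith
  · have := ((convexHull_subset hδ hT (hmem a _ h1)).1 a).2
    simp only [Pi.add_apply, Pi.single_eq_same] at this
    linarith
  · have := (convexHull_subset hδ hT (hmem b _ h1)).2 a b hab
    have hne : a ≠ b := by
      rintro rfl
      exact lt_irrefl _ hab
    simp only [Pi.add_apply, Pi.single_eq_same, Pi.single_eq_of_ne hne] at this
    linarith

theorem perm_eq_of_lt {n : ℕ} {ρ ρ' : Equiv.Perm (Fin n)} (h : ∀ a b, ρ a < ρ b → ρ' a < ρ' b) :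
    ρ' = ρ := by
  have hmono : StrictMono (ρ' ∘ ρ.symm) := by
    intro x y hxy
    exact h _ _ (by simpa using hxy)
  have h1 := (hmono.range_inj strictMono_id).1
    (by rw [Set.range_id, (ρ'.surjective.comp ρ.symm.surjective).range_eq])
  ext a
  have := congrFun h1 (ρ a)
  simp only [Function.comp_apply, Equiv.symm_apply_apply, id_eq] at this
  rw [this]

/-- The simplex of the triangulation on the lower boundary with `c` in its interior is the only one
on the lower boundary which contains `c`. -/
theorem initial_unique (hδ : 0 < δ) {c : Fin N → ℝ} {τ τ' η η' : Finset (Fin (N + 1) → ℝ)}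
    (hη : η ∈ K1Tilde N δ) (hτ : τ ⊆ η) (hcard : τ.card = N + 1) (h0 : OnLevel 0 τ)
    (hc : c ∈ interior (convexHull ℝ (proj '' (τ : Set (Fin (N + 1) → ℝ)))))
    (hη' : η' ∈ K1Tilde N δ) (hτ' : τ' ⊆ η') (hcard' : τ'.card = N + 1) (h0' : OnLevel 0 τ')
    (hc' : c ∈ convexHull ℝ (proj '' (τ' : Set (Fin (N + 1) → ℝ)))) : τ' = τ ∧ η' = η := by
  obtain ⟨z, ρ, hz, rfl⟩ := mem_K1Tilde_iff.1 hη
  obtain ⟨z', ρ', hz', rfl⟩ := mem_K1Tilde_iff.1 hη'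
  have hs : (τ : Set (Fin (N + 1) → ℝ)) ⊆ gridPoint δ '' (intSimplex z ρ : Set _) := by
    rw [← Finset.coe_image]
    exact Finset.coe_subset.2 hτ
  have hs' : (τ' : Set (Fin (N + 1) → ℝ)) ⊆ gridPoint δ '' (intSimplex z' ρ' : Set _) := by
    rw [← Finset.coe_image]
    exact Finset.coe_subset.2 hτ'
  obtain ⟨h1, h2⟩ := interior_convexHull_subset hδ hs hc
  obtain ⟨h1', h2'⟩ := convexHull_subset hδ hs' hc'
  obtain ⟨i, hi, rfl⟩ := exists_facet_eq hδ hτ hcard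
  obtain ⟨i', hi', rfl⟩ := exists_facet_eq hδ hτ' hcard'
  rw [← Int.cast_zero, onLevel_image_iff] at h0 h0'
  obtain ⟨rfl, hρ⟩ := facet_lower hz hi h0
  obtain ⟨rfl, hρ'⟩ := facet_lower hz' hi' h0'
  have hzz : z' = z := by
    funext a
    refine Fin.lastCases (hz'.trans hz.symm) (fun a => ?_) a
    have g1 := (h1 a).1.trans_le (h1' a).2
    have g2 := (h1' a).1.trans_lt (h1 a).2
    rw [mul_lt_mul_iff_of_pos_left hδ] at g1 g2
    have g3 : z a.castSucc < z' a.castSucc + 1 := by exact_mod_cast g1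
    have g4 : z' a.castSucc < z a.castSucc + 1 := by exact_mod_cast g2
    omega
  subst hzz
  have hρρ : ρ' = ρ := by
    apply perm_eq_of_lt
    intro a b
    refine Fin.lastCases (fun h => ?_) (fun a => ?_) a
    · rw [hρ] at h
      exact absurd h (not_lt.2 (Fin.le_last _))
    refine Fin.lastCases (fun _ => ?_) (fun b h => ?_) b
    · rw [hρ']
      refine lt_of_le_of_ne (Fin.le_last _) fun h => ?_
      exact (Fin.castSucc_lt_last a).ne (ρ'.injective (h.trans hρ'.symm))
    · by_contra hge
      rw [not_lt] at hge
      rcases hge.lt_or_eq with hlt | heq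
      · exact absurd (h2 a b h) (not_lt.2 (h2' b a hlt))
      · have := ρ'.injective heq
        rw [this] at h
        exact lt_irrefl _ h
  subst hρρ
  exact ⟨rfl, rfl⟩

/-- A simplex with a positive point in its interior lies in the orthant. -/
theorem initial_inOrthant (hδ : 0 < δ) {c : Fin N → ℝ} {τ η : Finset (Fin (N + 1) → ℝ)}
    (hη : η ∈ K1Tilde N δ) (hτ : τ ⊆ η)
    (hc : c ∈ interior (convexHull ℝ (proj '' (τ : Set (Fin (N + 1) → ℝ)))))
    (hpos : ∀ a, 0 < c a) : InOrthant τ := by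
  obtain ⟨z, ρ, hz, rfl⟩ := mem_K1Tilde_iff.1 hη
  have hs : (τ : Set (Fin (N + 1) → ℝ)) ⊆ gridPoint δ '' (intSimplex z ρ : Set _) := by
    rw [← Finset.coe_image]
    exact Finset.coe_subset.2 hτ
  obtain ⟨h1, -⟩ := interior_convexHull_subset hδ hs hc
  intro y hy a
  obtain ⟨v, hv, rfl⟩ := Finset.mem_image.1 (hτ hy)
  obtain ⟨j, hj, rfl⟩ := mem_intSimplex.1 hv
  have g1 : (0 : ℝ) < z a.castSucc + 1 :=
    (mul_pos_iff_of_pos_left hδ).1 ((hpos a).trans (h1 a).2)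
  have g2 : (0 : ℤ) < z a.castSucc + 1 := by exact_mod_cast g1
  have g3 : 0 ≤ vert z ρ j a.castSucc := by
    simp only [vert]
    split_ifs <;> omega
  rw [Pi.zero_apply, proj_gridPoint]
  exact mul_nonneg hδ.le (Int.cast_nonneg g3)

/-- The vertices of the starting simplex are affinely independent, and the first column of the
inverse of its labeling matrix consists of the barycentric coordinates of `c`, which are positive. -/
theorem initial_isComplete (φ : (Fin N → ℝ) → (Fin N → ℝ)) {c : Fin N → ℝ}
    {τ : Finset (Fin (N + 1) → ℝ)} (hcard : τ.card = N + 1) (h0 : OnLevel 0 τ)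
    (hc : c ∈ interior (convexHull ℝ (proj '' (τ : Set (Fin (N + 1) → ℝ)))))
    (horth : InOrthant τ) : IsComplete φ c τ := by
  let P : τ → (Fin N → ℝ) := fun y => proj (y : Fin (N + 1) → ℝ)
  have hrange : Set.range P = proj '' (τ : Set (Fin (N + 1) → ℝ)) := by
    ext u
    simp [P]
  have htop : affineSpan ℝ (Set.range P) = ⊤ := by
    rw [hrange, ← interior_convexHull_nonempty_iff_affineSpan_eq_top]
    exact ⟨c, hc⟩
  have hind : AffineIndependent ℝ P := by
    rw [affineIndependent_iff_le_finrank_vectorSpan ℝ P (n := N) (by simp [hcard]),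
      ← direction_affineSpan, htop, AffineSubspace.direction_top, finrank_top]
    simp
  let b : AffineBasis τ ℝ (Fin N → ℝ) := ⟨P, hind, htop⟩
  have hb : ∀ y, b y = P y := fun y => rfl
  have hpos : ∀ y, 0 < b.coord y c := by
    have h1 : c ∈ interior (convexHull ℝ (Set.range b)) := by
      change c ∈ interior (convexHull ℝ (Set.range P))
      rwa [hrange]
    rw [AffineBasis.interior_convexHull] at h1
    exact h1
  have hcomb : ∀ (u : Fin N → ℝ) k, ∑ y, b.coord y u * P y k = u k := by
    intro u k
    have := congrFun (b.linear_combination_coord_eq_self u) k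
    simpa [hb] using this
  have hlab : ∀ y : τ, ∀ k, label φ c (y : Fin (N + 1) → ℝ) k = c k - P y k := by
    intro y k
    simp [label, h0 y.1 y.2, P]
  refine ⟨hcard, horth, Matrix.of fun y => Fin.cons (b.coord y c)
    (fun i => b.coord y c - b.coord y (c + Pi.single i 1)), ?_, fun y => ⟨0, hpos y, ?_⟩⟩
  · ext r s
    rw [Matrix.mul_apply]
    simp only [labelMatrix, Matrix.of_apply, labelCol]
    refine Fin.cases ?_ (fun k => ?_) r <;> refine Fin.cases ?_ (fun i => ?_) s
    · simp only [Fin.cons_zero, one_mul, b.sum_coord_apply_eq_one, Matrix.one_apply_eq]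
    · simp only [Fin.cons_zero, Fin.cons_succ, one_mul, Finset.sum_sub_distrib,
        b.sum_coord_apply_eq_one, sub_self, Matrix.one_apply_ne (Fin.succ_ne_zero i).symm]
    · simp only [Fin.cons_succ, Fin.cons_zero, hlab, sub_mul, Finset.sum_sub_distrib,
        ← Finset.mul_sum, b.sum_coord_apply_eq_one]
      simp_rw [mul_comm (P _ k)]
      rw [hcomb, Matrix.one_apply, if_neg (Fin.succ_ne_zero k)]
      ring
    · simp only [Fin.cons_succ, hlab, sub_mul, mul_sub, Finset.sum_sub_distrib,
        ← Finset.mul_sum, b.sum_coord_apply_eq_one]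
      simp_rw [mul_comm (P _ k)]
      rw [hcomb, hcomb, Matrix.one_apply]
      simp [Pi.single_apply]
  · intro j hj
    exact absurd hj (Fin.not_lt_zero j)

end Start

/-! ### Complete facets and pivoting -/

section Complete

variable {N : ℕ} {φ : (Fin N → ℝ) → (Fin N → ℝ)} {c : Fin N → ℝ}

theorem labelMatrix_mul_iff {τ : Finset (Fin (N + 1) → ℝ)} {M : Matrix τ (Fin (N + 1)) ℝ}
    {W : (Fin (N + 1) → ℝ) → Fin (N + 1) → ℝ} (hMW : ∀ y : τ, M y = W y) :
    labelMatrix φ c τ * M = 1 ↔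
      ∀ r s, ∑ y ∈ τ, labelCol φ c y r * W y s = if r = s then 1 else 0 := by
  rw [← Matrix.ext_iff]
  refine forall_congr' fun r => forall_congr' fun s => ?_
  rw [Matrix.mul_apply, Matrix.one_apply, ← Finset.sum_coe_sort τ]
  simp only [labelMatrix, Matrix.of_apply, hMW]

theorem exists_extension {τ : Finset (Fin (N + 1) → ℝ)} (M : Matrix τ (Fin (N + 1)) ℝ) :
    ∃ W : (Fin (N + 1) → ℝ) → Fin (N + 1) → ℝ, ∀ y : τ, M y = W y := by
  classical
  exact ⟨fun y => if h : y ∈ τ then M ⟨y, h⟩ else 0, fun y => by simp⟩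

theorem isComplete_iff {τ : Finset (Fin (N + 1) → ℝ)} :
    IsComplete φ c τ ↔ InOrthant τ ∧ ∃ W, IsDual (labelCol φ c) τ W ∧ ∀ y ∈ τ, LexPos (W y) := by
  constructor
  · rintro ⟨hcard, horth, M, hM, hpos⟩
    obtain ⟨W, hW⟩ := exists_extension M
    refine ⟨horth, W, ⟨hcard, (labelMatrix_mul_iff hW).1 hM⟩, fun y hy => ?_⟩
    rw [← hW ⟨y, hy⟩]
    exact hpos _
  · rintro ⟨horth, W, hW, hpos⟩
    exact ⟨hW.1, horth, fun y => W y, (labelMatrix_mul_iff fun _ => rfl).2 hW.2,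
      fun y => hpos y y.2⟩

theorem isPivot_iff {τ : Finset (Fin (N + 1) → ℝ)}
    {W : (Fin (N + 1) → ℝ) → Fin (N + 1) → ℝ} (hW : IsDual (labelCol φ c) τ W)
    {y₁ : Fin (N + 1) → ℝ} (hy₁ : y₁ ∉ τ) {ζ : Fin (N + 1) → ℝ} :
    IsPivot φ c (insert y₁ τ) τ ζ ↔ IsLexMin τ W (labelCol φ c y₁) ζ := by
  have hp : ∀ (M : Matrix τ (Fin (N + 1)) ℝ), (∀ y : τ, M y = W y) → ∀ y : τ,
      M.mulVec (labelCol φ c y₁) y = dualCoord W (labelCol φ c y₁) y := by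
    intro M hM y
    simp only [Matrix.mulVec, dotProduct, dualCoord, hM]
  constructor
  · rintro ⟨M, hM, y, hy, hζ, hpos, hmin⟩
    have hMW : ∀ y : τ, M y = W y := by
      intro y
      obtain ⟨V, hV⟩ := exists_extension M
      rw [hV]
      exact hW.unique ((labelMatrix_mul_iff hV).1 hM) y.2
    obtain rfl : y = y₁ := by
      rw [Finset.mem_sdiff, Finset.mem_insert] at hy
      exact hy.1.resolve_right hy.2
    rw [hp M hMW] at hpos
    refine ⟨hζ, hpos, fun h hh hne hph => ?_⟩
    have := hmin ⟨h, hh⟩ (fun h' => hne (congrArg Subtype.val h')) (by rwa [hp M hMW])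
    rwa [hp M hMW, hp M hMW, hMW, hMW] at this
  · rintro ⟨hζ, hpos, hmin⟩
    have hMW : ∀ y : τ, (Matrix.of fun (y : τ) => W y) y = W y := fun _ => rfl
    refine ⟨Matrix.of fun (y : τ) => W y, (labelMatrix_mul_iff hMW).2 hW.2, y₁, by simp [hy₁], hζ,
      ?_, fun h hne hph => ?_⟩
    · rw [hp _ hMW]
      exact hpos
    · rw [hp _ hMW] at hph
      rw [hp _ hMW, hp _ hMW]
      exact hmin h h.2 (fun h' => hne (Subtype.ext h')) hph

theorem exists_eq_insert_of_facet {η τ : Finset (Fin (N + 1) → ℝ)} (hη : η.card = N + 2)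
    (hτ : τ ⊆ η) (hcard : τ.card = N + 1) : ∃ y₁, y₁ ∉ τ ∧ η = insert y₁ τ := by
  obtain ⟨y, hy, h⟩ := Finset.exists_eq_insert_iff.2 ⟨hτ, by rw [hη, hcard]⟩
  exact ⟨y, hy, h.symm⟩

/-- A pivot leads from a complete facet to the other complete facet of the same simplex. -/
theorem exists_isPivot_iff {η τ τ' : Finset (Fin (N + 1) → ℝ)} (hη : η.card = N + 2)
    (horth : InOrthant η) (hτ : IsComplete φ c τ) (hsub : τ ⊆ η) :
    (∃ ζ, IsPivot φ c η τ ζ ∧ τ' = η.erase ζ) ↔ IsComplete φ c τ' ∧ τ' ⊆ η ∧ τ' ≠ τ := by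
  obtain ⟨y₁, hy₁, rfl⟩ := exists_eq_insert_of_facet hη hsub hτ.1
  obtain ⟨-, W, hW, hpos⟩ := isComplete_iff.1 hτ
  constructor
  · rintro ⟨ζ, hζ, rfl⟩
    rw [isPivot_iff hW hy₁] at hζ
    refine ⟨isComplete_iff.2 ⟨fun y hy => horth y (Finset.mem_of_mem_erase hy),
      hW.pivot hpos hy₁ hζ⟩, Finset.erase_subset _ _, fun h => ?_⟩
    have := hζ.1
    rw [← h] at this
    exact Finset.notMem_erase _ _ this
  · rintro ⟨hτ', hsub', hne⟩
    obtain ⟨-, V, hV, hVpos⟩ := isComplete_iff.1 hτ'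
    obtain ⟨ζ, hζ, heq⟩ := exists_eq_insert_of_facet hη hsub' hτ'.1
    have hτ'' : τ' = (insert y₁ τ).erase ζ := by rw [heq, Finset.erase_insert hζ]
    have hζτ : ζ ∈ τ := by
      have h1 : ζ ∈ insert y₁ τ := by
        rw [heq]
        exact Finset.mem_insert_self _ _
      refine (Finset.mem_insert.1 h1).resolve_left ?_
      rintro rfl
      exact hne (by rw [hτ'', Finset.erase_insert hy₁])
    subst hτ''
    exact ⟨ζ, (isPivot_iff hW hy₁).2 (hW.isLexMin_of_exchange hpos hy₁ hζτ hV hVpos), rfl⟩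

/-- A simplex in the orthant with a complete facet has exactly two complete facets. -/
theorem exists_other_facet {η τ : Finset (Fin (N + 1) → ℝ)} (hη : η.card = N + 2)
    (horth : InOrthant η) (hτ : IsComplete φ c τ) (hsub : τ ⊆ η) :
    ∃ τ', IsComplete φ c τ' ∧ τ' ⊆ η ∧ τ' ≠ τ ∧
      ∀ τ'', IsComplete φ c τ'' → τ'' ⊆ η → τ'' = τ ∨ τ'' = τ' := by
  obtain ⟨y₁, hy₁, rfl⟩ := exists_eq_insert_of_facet hη hsub hτ.1
  obtain ⟨-, W, hW, hpos⟩ := isComplete_iff.1 hτ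
  -- The first row of the labeling matrix consists of ones, so the coordinates of any column add up
  -- to one.
  have hex : ∃ y ∈ τ, 0 < dualCoord W (labelCol φ c y₁) y := by
    by_contra hcon
    push Not at hcon
    have h1 := hW.sum_dualCoord (labelCol φ c y₁) 0
    simp only [labelCol, Fin.cons_zero, mul_one] at h1
    have h2 := Finset.sum_nonpos hcon
    simp only [labelCol] at h2
    linarith
  obtain ⟨ζ, hζ⟩ := hW.exists_isLexMin hex
  obtain ⟨h1, h2, h3⟩ := (exists_isPivot_iff hη horth hτ hsub).1
    ⟨ζ, (isPivot_iff hW hy₁).2 hζ, rfl⟩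
  refine ⟨_, h1, h2, h3, fun τ'' h4 h5 => or_iff_not_imp_left.2 fun h6 => ?_⟩
  obtain ⟨ζ', hζ', rfl⟩ := (exists_isPivot_iff hη horth hτ hsub).2 ⟨h4, h5, h6⟩
  rw [((isPivot_iff hW hy₁).1 hζ').unique hζ]

/-- A complete facet carries an approximate zero of the homotopy. -/
theorem IsComplete.exists_weights {τ : Finset (Fin (N + 1) → ℝ)} (h : IsComplete φ c τ) :
    ∃ lam : τ → ℝ, (∀ y, 0 ≤ lam y) ∧ (labelMatrix φ c τ).mulVec lam = Pi.single 0 1 := by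
  obtain ⟨-, -, W, hW, hpos⟩ := h
  refine ⟨fun y => W y 0, fun y => (hpos y).zero_le, ?_⟩
  funext r
  have := congrFun (congrFun hW r) 0
  rw [Matrix.mul_apply, Matrix.one_apply] at this
  simp only [Matrix.mulVec, dotProduct]
  rw [this, Pi.single_apply]

/-- The equations `L(τ) λ = e₁` say that the convex combinations with weights `λ` of the vertices
and of the values of the homotopy coincide. -/
theorem weights_of_mulVec_eq {τ : Finset (Fin (N + 1) → ℝ)} {lam : τ → ℝ}
    (h : (labelMatrix φ c τ).mulVec lam = Pi.single 0 1) : ∑ y, lam y = 1 ∧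
      ∀ a, ∑ y : τ, lam y * (((1 - y.1 (Fin.last N)) * c a +
        y.1 (Fin.last N) * φ (proj y.1) a)) = ∑ y : τ, lam y * proj y.1 a := by
  refine ⟨?_, fun a => ?_⟩
  · have := congrFun h 0
    simpa [Matrix.mulVec, dotProduct, labelMatrix, labelCol] using this
  · have := congrFun h a.succ
    simp only [Matrix.mulVec, dotProduct, labelMatrix, labelCol, Matrix.of_apply, Fin.cons_succ,
      label, Pi.sub_apply, Pi.add_apply, Pi.smul_apply, smul_eq_mul,
      Pi.single_eq_of_ne (Fin.succ_ne_zero a), sub_mul _ (proj _ a), Finset.sum_sub_distrib]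
      at this
    simp_rw [mul_comm (lam _)]
    linarith

end Complete

/-! ### The Euclidean norm -/

section Norm

variable {N : ℕ}

theorem euclNorm_nonneg (v : Fin N → ℝ) : 0 ≤ euclNorm v := norm_nonneg _

theorem euclNorm_zero : euclNorm (0 : Fin N → ℝ) = 0 := by
  simp [euclNorm]

theorem continuous_euclNorm : Continuous (euclNorm : (Fin N → ℝ) → ℝ) := by
  unfold euclNorm
  fun_prop

theorem abs_le_euclNorm (v : Fin N → ℝ) (a : Fin N) : |v a| ≤ euclNorm v :=
  PiLp.norm_apply_le (WithLp.toLp 2 v : EuclideanSpace ℝ (Fin N)) a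

theorem euclNorm_le_of_abs_le {u v : Fin N → ℝ} (h : ∀ a, |u a| ≤ v a) :
    euclNorm u ≤ euclNorm v := by
  unfold euclNorm
  rw [EuclideanSpace.norm_eq, EuclideanSpace.norm_eq]
  refine Real.sqrt_le_sqrt (Finset.sum_le_sum fun a _ => ?_)
  simp only [Real.norm_eq_abs]
  exact pow_le_pow_left₀ (abs_nonneg _) ((h a).trans (le_abs_self _)) 2

theorem euclNorm_add_le (u v : Fin N → ℝ) : euclNorm (u + v) ≤ euclNorm u + euclNorm v := by
  unfold euclNorm
  rw [WithLp.toLp_add]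
  exact norm_add_le _ _

theorem euclNorm_const {d : ℝ} (hd : 0 ≤ d) :
    euclNorm (fun _ : Fin N => d) = d * Real.sqrt N := by
  unfold euclNorm
  rw [EuclideanSpace.norm_eq]
  simp [Real.sqrt_sq hd, mul_comm]

theorem euclNorm_le_add {u v : Fin N → ℝ} {d : ℝ} (hd : 0 ≤ d) (h : ∀ a, |u a - v a| ≤ d) :
    euclNorm u ≤ euclNorm v + d * Real.sqrt N := by
  have h1 := euclNorm_add_le v (u - v)
  have h2 : euclNorm (u - v) ≤ euclNorm (fun _ : Fin N => d) := euclNorm_le_of_abs_le h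
  rw [add_sub_cancel] at h1
  rw [euclNorm_const hd] at h2
  linarith

end Norm

/-! ### The gain operator -/

section Gain

variable {N : ℕ} {Γ : Fin N → Fin N → ℝ≥0 → ℝ≥0} {μ : Fin N → (Fin N → ℝ≥0) → ℝ≥0}

theorem IsGainMatrix.continuous (hΓ : IsGainMatrix Γ) (i j : Fin N) : Continuous (Γ i j) := by
  rcases hΓ i j with h | h
  · exact h.2.1
  · rw [h]
    exact continuous_const

theorem IsGainMatrix.monotone (hΓ : IsGainMatrix Γ) (i j : Fin N) : Monotone (Γ i j) := by
  rcases hΓ i j with h | h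
  · exact h.1.monotone
  · rw [h]
    exact monotone_const

/-- Strict monotonicity with respect to `≪` and continuity give monotonicity. -/
theorem IsMAF.monotone {μ : (Fin N → ℝ≥0) → ℝ≥0} (hμ : IsMAF μ) : Monotone μ := by
  intro s t hst
  have h1 : Filter.Tendsto (fun ε : ℝ≥0 => μ (fun i => t i + ε)) (nhdsWithin 0 (Set.Ioi 0))
      (nhds (μ (fun i => t i + 0))) := by
    refine (Continuous.tendsto ?_ 0).mono_left nhdsWithin_le_nhds
    exact hμ.continuous.comp (by fun_prop)
  simp only [add_zero] at h1
  refine ge_of_tendsto h1 ?_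
  filter_upwards [self_mem_nhdsWithin] with ε hε
  exact (hμ.strict_increase _ _ fun i => lt_of_le_of_lt (hst i) (lt_add_of_pos_right _ hε)).le

theorem gainOp_continuous (hΓ : IsGainMatrix Γ) (hμ : ∀ i, IsMAF (μ i)) :
    Continuous (gainOp Γ μ) := by
  refine continuous_pi fun i => (hμ i).continuous.comp (continuous_pi fun j => ?_)
  exact (hΓ.continuous i j).comp (continuous_apply j)

theorem gainOp_monotone (hΓ : IsGainMatrix Γ) (hμ : ∀ i, IsMAF (μ i)) :
    Monotone (gainOp Γ μ) := fun _ _ hst i =>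
  (hμ i).monotone fun j => hΓ.monotone i j (hst j)

theorem eq_zero_of_gainOp_eq_zero (hΓ : IsGainMatrix Γ) (hμ : ∀ i, IsMAF (μ i)) {s : Fin N → ℝ≥0}
    {i j : Fin N} (h : gainOp Γ μ s i = 0) (hij : Γ i j ≠ 0) : s j = 0 := by
  have h1 := congrFun (((hμ i).eq_zero_iff _).1 h) j
  have hK := (hΓ i j).resolve_right hij
  exact hK.1.injective (h1.trans hK.2.2.1.symm)

/-- For an irreducible gain matrix, a nonempty set of indices closed under passing to the
arguments of the gains is everything. -/
theorem eq_univ_of_closed (hirr : IsIrreducibleMatrix (adjMatrix Γ)) {Z : Set (Fin N)}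
    (hne : Z.Nonempty) (hZ : ∀ i ∈ Z, ∀ j, Γ i j ≠ 0 → j ∈ Z) : Z = Set.univ := by
  classical
  by_contra hcon
  apply hirr
  set m := Fintype.card {i // i ∉ Z} with hm
  have hmN : m + Fintype.card {i // i ∈ Z} = N := by
    rw [hm, add_comm, ← Fintype.card_sum, Fintype.card_congr (Equiv.sumCompl (· ∈ Z)),
      Fintype.card_fin]
  have hm0 : 0 < m := by
    obtain ⟨i, hi⟩ := (Set.ne_univ_iff_exists_notMem _).1 hcon
    exact Fintype.card_pos_iff.2 ⟨⟨i, hi⟩⟩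
  have hmZ : 0 < Fintype.card {i // i ∈ Z} := by
    obtain ⟨i, hi⟩ := hne
    exact Fintype.card_pos_iff.2 ⟨⟨i, hi⟩⟩
  have e : {i : Fin N // i.val < m} ≃ {i // i ∉ Z} := by
    refine Fintype.equivOfCardEq ?_
    rw [← hm, Fintype.card_subtype]
    have : (Finset.univ.filter fun i : Fin N => i.val < m) =
        (Finset.univ : Finset (Fin m)).image (Fin.castLE (by omega)) := by
      ext i
      simp only [Finset.mem_filter, Finset.mem_univ, true_and, Finset.mem_image]
      constructor
      · intro h
        exact ⟨⟨i, h⟩, rfl⟩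
      · rintro ⟨j, rfl⟩
        exact j.2
    rw [this, Finset.card_image_of_injective _ (Fin.castLE_injective _), Finset.card_univ,
      Fintype.card_fin]
  refine ⟨e.extendSubtype, m, hm0, by omega, fun i j hi hj => ?_⟩
  have hi' : e.extendSubtype i ∈ Z := by
    have := e.extendSubtype_not_mem i (not_lt.2 hi)
    exact not_not.1 this
  have hj' : e.extendSubtype j ∉ Z := e.extendSubtype_mem j hj
  simp only [adjMatrix, Matrix.of_apply]
  rw [if_pos]
  by_contra hne
  exact hj' (hZ _ hi' _ hne)

end Gain

/-! ### The homotopy -/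

/-- The standing assumptions: an irreducible gain operator with the small gain property, and the
parameters of the map `φ` and of the homotopy. -/
structure Setting {N : ℕ} (Γ : Fin N → Fin N → ℝ≥0 → ℝ≥0) (μ : Fin N → (Fin N → ℝ≥0) → ℝ≥0)
    (κ₀ κΓ κh : ℝ) (c : Fin N → ℝ) (k : ℕ) : Prop where
  one_le : 1 ≤ N
  gain : IsGainMatrix Γ
  irreducible : IsIrreducibleMatrix (adjMatrix Γ)
  maf : ∀ i, IsMAF (μ i)
  smallGain : SmallGain (gainOp Γ μ)
  κ₀_pos : 0 < κ₀
  κh_pos : 0 < κh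
  κh_lt : κh < κΓ
  c_nonneg : 0 ≤ c
  norm_c : euclNorm c < κΓ / 2
  one_le_k : 1 ≤ k
  lt_c : (1 / (2 * (k : ℝ) - 1)) • toReal (gainOp Γ μ (fun _ => (κΓ + κ₀).toNNReal)) < c

namespace Setting

variable {N : ℕ} {Γ : Fin N → Fin N → ℝ≥0 → ℝ≥0} {μ : Fin N → (Fin N → ℝ≥0) → ℝ≥0}
  {κ₀ κΓ κh : ℝ} {c : Fin N → ℝ} {k : ℕ}

theorem phi_continuous (S : Setting Γ μ κ₀ κΓ κh c k) :
    Continuous (phi (gainOp Γ μ) κ₀ κΓ κh) := by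
  have h1 : Continuous fun v : Fin N → ℝ => gainOp Γ μ (fun j => (v j).toNNReal) :=
    (gainOp_continuous S.gain S.maf).comp
      (continuous_pi fun j => continuous_real_toNNReal.comp (continuous_apply j))
  refine continuous_pi fun i => ?_
  have h2 : Continuous fun v : Fin N → ℝ => (gainOp Γ μ (fun j => (v j).toNNReal) i : ℝ) :=
    NNReal.continuous_coe.comp ((continuous_apply i).comp h1)
  have h3 := continuous_euclNorm (N := N)
  have h4 : ∀ v : Fin N → ℝ, euclNorm v + κ₀ ≠ 0 := fun v =>
    (add_pos_of_nonneg_of_pos (euclNorm_nonneg v) S.κ₀_pos).ne'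
  unfold phi
  refine (h2.mul (continuous_const.add (continuous_const.min ?_))).add
    (continuous_const.max (continuous_const.sub (continuous_const.mul h3)))
  exact (continuous_const.sub (continuous_const.mul h3)).div (h3.add continuous_const) h4

/-- Irreducibility makes all components of `c` positive. -/
theorem c_pos (S : Setting Γ μ κ₀ κΓ κh c k) (a : Fin N) : 0 < c a := by
  have hk : (0 : ℝ) < 2 * k - 1 := by
    have : (1 : ℝ) ≤ k := by exact_mod_cast S.one_le_k
    linarith
  refine lt_of_le_of_ne (S.c_nonneg a) fun h0 => ?_
  -- If `c a = 0` then no gain in row `a` is nonzero, so `a` is the only index.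
  have h1 := S.lt_c.le a
  rw [← h0] at h1
  simp only [Pi.smul_apply, toReal, smul_eq_mul] at h1
  have h2 : gainOp Γ μ (fun _ => (κΓ + κ₀).toNNReal) a = 0 := by
    have h3 : (0 : ℝ) < 1 / (2 * k - 1) := one_div_pos.2 hk
    have h4 := nonpos_of_mul_nonpos_right h1 h3
    exact NNReal.coe_eq_zero.1 (le_antisymm h4 (NNReal.coe_nonneg _))
  have huniv : ({a} : Set (Fin N)) = Set.univ := by
    refine eq_univ_of_closed S.irreducible (Set.singleton_nonempty a) ?_
    rintro i rfl j hij
    have h5 := eq_zero_of_gainOp_eq_zero S.gain S.maf h2 hij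
    rw [Real.toNNReal_eq_zero] at h5
    linarith [S.κ₀_pos, S.κh_pos, S.κh_lt]
  refine (lt_irrefl _ (S.lt_c.trans_le fun b => ?_))
  have hb : b = a := by
    have : b ∈ ({a} : Set (Fin N)) := huniv ▸ Set.mem_univ b
    exact this
  rw [hb, ← h0]
  exact mul_nonneg (one_div_pos.2 hk).le (NNReal.coe_nonneg _)

/-- The factor of `Γ_μ` in `φ` is positive inside the ball of radius `κΓ + κ₀`. -/
theorem factor_pos (S : Setting Γ μ κ₀ κΓ κh c k) {r : ℝ} (hr : 0 ≤ r) (h : r < κΓ + κ₀) :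
    0 < 1 + min 0 ((κΓ - 2 * r) / (r + κ₀)) := by
  have h1 : 0 < r + κ₀ := add_pos_of_nonneg_of_pos hr S.κ₀_pos
  have h2 : -1 < (κΓ - 2 * r) / (r + κ₀) := by
    rw [lt_div_iff₀ h1]
    linarith
  have h3 : (-1 : ℝ) < min 0 ((κΓ - 2 * r) / (r + κ₀)) := lt_min (by norm_num) h2
  linarith

theorem phi_zero_pos (S : Setting Γ μ κ₀ κΓ κh c k) (a : Fin N) :
    0 < phi (gainOp Γ μ) κ₀ κΓ κh 0 a := by
  have h := S.factor_pos (r := 0) le_rfl (by linarith [S.κ₀_pos, S.κh_pos, S.κh_lt])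
  simp only [phi, euclNorm_zero]
  exact add_pos_of_nonneg_of_pos (mul_nonneg (NNReal.coe_nonneg _) h.le)
    (lt_max_of_lt_right (by linarith [S.κh_pos]))

/-- Close to the sphere of radius `κΓ + κ₀` and beyond, `φ` is bounded by `c`. -/
theorem phi_le_c (S : Setting Γ μ κ₀ κΓ κh c k) {v : Fin N → ℝ}
    (h1 : κΓ / 2 < euclNorm v)
    (h2 : 2 * k * (κΓ + κ₀) - (κΓ + 2 * κ₀) ≤ 2 * k * euclNorm v) (a : Fin N) :
    phi (gainOp Γ μ) κ₀ κΓ κh v a ≤ c a := by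
  have hk : (0 : ℝ) < 2 * k - 1 := by
    have : (1 : ℝ) ≤ k := by exact_mod_cast S.one_le_k
    linarith
  have hκ₀ := S.κ₀_pos
  have hκh := S.κh_lt
  have hr := euclNorm_nonneg v
  set r := euclNorm v with hrdef
  have hden : 0 < r + κ₀ := add_pos_of_nonneg_of_pos hr hκ₀
  have hmax : max 0 (κh - 2 * r) = 0 := max_eq_left (by linarith)
  have hmin : min 0 ((κΓ - 2 * r) / (r + κ₀)) = (κΓ - 2 * r) / (r + κ₀) :=
    min_eq_right (div_nonpos_of_nonpos_of_nonneg (by linarith) hden.le)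
  have hfac : 1 + (κΓ - 2 * r) / (r + κ₀) = (κΓ + κ₀ - r) / (r + κ₀) := by
    field_simp
    ring
  have hT : (0 : ℝ) ≤ gainOp Γ μ (fun j => (v j).toNNReal) a := NNReal.coe_nonneg _
  simp only [phi]
  rw [← hrdef, hmax, hmin, hfac, add_zero]
  rcases le_or_gt (κΓ + κ₀) r with hge | hlt
  · refine le_trans ?_ (S.c_nonneg a)
    exact mul_nonpos_of_nonneg_of_nonpos hT
      (div_nonpos_of_nonpos_of_nonneg (by linarith) hden.le)
  · have h3 : (κΓ + κ₀ - r) / (r + κ₀) ≤ 1 / (2 * k - 1) := by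
      rw [div_le_div_iff₀ hden hk]
      nlinarith
    have h4 : gainOp Γ μ (fun j => (v j).toNNReal) a ≤
        gainOp Γ μ (fun _ => (κΓ + κ₀).toNNReal) a := by
      refine gainOp_monotone S.gain S.maf (fun j => Real.toNNReal_le_toNNReal ?_) a
      exact (le_abs_self _).trans ((abs_le_euclNorm v j).trans hlt.le)
    have h5 := S.lt_c.le a
    simp only [Pi.smul_apply, toReal, smul_eq_mul] at h5
    refine le_trans ?_ h5
    rw [mul_comm]
    exact mul_le_mul h3 (NNReal.coe_le_coe.2 h4) hT (one_div_pos.2 hk).le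

/-- The fixed points of `φ` in the orthant are decay points of the gain operator: a fixed point
outside the ball of radius `κh / 2` would contradict the small gain condition, and inside this
ball `φ` exceeds the gain operator in all components. -/
theorem decay_of_fixed (S : Setting Γ μ κ₀ κΓ κh c k) {x : Fin N → ℝ} (hx : 0 ≤ x)
    (hfix : phi (gainOp Γ μ) κ₀ κΓ κh x = x) :
    (fun j => (x j).toNNReal) ∈ decaySet (gainOp Γ μ) := by
  set s : Fin N → ℝ≥0 := fun j => (x j).toNNReal with hs
  have hsx : ∀ j, (s j : ℝ) = x j := fun j => Real.coe_toNNReal _ (hx j)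
  have hval : ∀ i, x i = (gainOp Γ μ s i : ℝ) *
      (1 + min 0 ((κΓ - 2 * euclNorm x) / (euclNorm x + κ₀))) +
        max 0 (κh - 2 * euclNorm x) := fun i => by
    conv_lhs => rw [← hfix]
    rfl
  have hr := euclNorm_nonneg x
  have hden : 0 < euclNorm x + κ₀ := add_pos_of_nonneg_of_pos hr S.κ₀_pos
  have hκ := S.κh_lt
  intro i
  have hlt : 2 * euclNorm x < κh := by
    by_contra hge
    rw [not_lt] at hge
    have hmax : max 0 (κh - 2 * euclNorm x) = 0 := max_eq_left (by linarith)
    have hs0 : s ≠ 0 := by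
      intro h0
      have hx0 : x = 0 := by
        funext j
        rw [← hsx, h0]
        rfl
      rw [hx0, euclNorm_zero] at hge
      linarith [S.κh_pos]
    refine S.smallGain s hs0 fun j => ?_
    have h1 := hval j
    rw [hmax, add_zero] at h1
    rw [← NNReal.coe_le_coe, hsx, h1]
    exact mul_le_of_le_one_right (NNReal.coe_nonneg _) (by
      linarith [min_le_left (0 : ℝ) ((κΓ - 2 * euclNorm x) / (euclNorm x + κ₀))])
  have h1 := hval i
  rw [min_eq_left (div_nonneg (by linarith) hden.le), max_eq_right (by linarith), add_zero,
    mul_one] at h1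
  rw [← NNReal.coe_lt_coe, hsx]
  linarith

variable {δ : ℝ} {η τ : Finset (Fin (N + 1) → ℝ)}

theorem mesh_bound (S : Setting Γ μ κ₀ κΓ κh c k) (hδ : Admissible κ₀ κΓ κh k c δ) :
    2 * k * (δ * Real.sqrt N) < κΓ + 2 * κ₀ := by
  have h1 := lt_of_lt_of_le hδ.2.1 (min_le_right _ _)
  have hk : (0 : ℝ) < k := by exact_mod_cast S.one_le_k
  have hN : (0 : ℝ) < Real.sqrt N := Real.sqrt_pos.2 (by exact_mod_cast S.one_le)
  rw [lt_div_iff₀ (by positivity)] at h1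
  linarith

/-- Boundedness: all vertices of a simplex carrying an approximate zero of the homotopy lie in the
ball of radius `κΓ + κ₀`. Otherwise all of them would lie in the region where `φ ≤ c`, and the
approximate zero, which is a convex combination of `c` and these values of `φ`, would lie in the
ball of radius `κΓ / 2`. -/
theorem norm_lt (S : Setting Γ μ κ₀ κΓ κh c k) (hδ : Admissible κ₀ κΓ κh k c δ)
    (hη : η ∈ K1Tilde N δ) (hτ : τ ⊆ η) (horth : InOrthant τ) {lam : τ → ℝ}
    (hlam : ∀ y, 0 ≤ lam y)
    (hsol : (labelMatrix (phi (gainOp Γ μ) κ₀ κΓ κh) c τ).mulVec lam = Pi.single 0 1)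
    {y : Fin (N + 1) → ℝ} (hy : y ∈ τ) : euclNorm (proj y) < κΓ + κ₀ := by
  by_contra hge
  rw [not_lt] at hge
  have hmesh := S.mesh_bound hδ
  have hk : (1 : ℝ) ≤ k := by exact_mod_cast S.one_le_k
  have hD : 0 ≤ δ * Real.sqrt N := mul_nonneg hδ.1.le (Real.sqrt_nonneg _)
  have hD2 : 2 * (δ * Real.sqrt N) < κΓ + 2 * κ₀ := by nlinarith
  obtain ⟨hsum, heq⟩ := weights_of_mulVec_eq hsol
  have hle : ∀ z : τ, ∀ a, phi (gainOp Γ μ) κ₀ κΓ κh (proj z.1) a ≤ c a := by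
    intro z
    have h1 : euclNorm (proj y) ≤ euclNorm (proj z.1) + δ * Real.sqrt N :=
      euclNorm_le_add hδ.1.le (abs_proj_sub_le hδ.1 hη (hτ hy) (hτ z.2))
    refine S.phi_le_c (by linarith) ?_
    have h2 : κΓ + κ₀ - δ * Real.sqrt N ≤ euclNorm (proj z.1) := by linarith
    have h3 := mul_le_mul_of_nonneg_left h2 (show (0 : ℝ) ≤ 2 * k by linarith)
    linarith
  set u : Fin N → ℝ := fun a => ∑ z : τ, lam z * proj z.1 a with hu
  have hu0 : ∀ a, 0 ≤ u a := fun a =>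
    Finset.sum_nonneg fun z _ => mul_nonneg (hlam z) (horth z.1 z.2 a)
  have huc : ∀ a, u a ≤ c a := by
    intro a
    simp only [hu]
    rw [← heq a]
    calc _ ≤ ∑ z, lam z * c a := by
          refine Finset.sum_le_sum fun z _ => mul_le_mul_of_nonneg_left ?_ (hlam z)
          rcases last_eq_zero_or_one hη (hτ z.2) with h | h
          · simp [h]
          · simpa [h] using hle z a
      _ = c a := by rw [← Finset.sum_mul, hsum, one_mul]
  have h1 : euclNorm u ≤ euclNorm c :=
    euclNorm_le_of_abs_le fun a => by rw [abs_of_nonneg (hu0 a)]; exact huc a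
  have h2 : euclNorm (proj y) ≤ euclNorm u + δ * Real.sqrt N := by
    refine euclNorm_le_add hδ.1.le fun a => ?_
    have h3 : proj y a - u a = ∑ z : τ, lam z * (proj y a - proj z.1 a) := by
      simp only [mul_sub, Finset.sum_sub_distrib, ← Finset.sum_mul, hsum, one_mul, hu]
    rw [h3]
    calc _ ≤ ∑ z : τ, |lam z * (proj y a - proj z.1 a)| := Finset.abs_sum_le_sum_abs _ _
      _ ≤ ∑ z : τ, lam z * δ := by
          refine Finset.sum_le_sum fun z _ => ?_
          rw [abs_mul, abs_of_nonneg (hlam z)]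
          exact mul_le_mul_of_nonneg_left (abs_proj_sub_le hδ.1 hη (hτ hy) (hτ z.2) a) (hlam z)
      _ = δ := by rw [← Finset.sum_mul, hsum, one_mul]
  linarith [S.norm_c]

/-- A complete facet is not contained in the boundary of the orthant. If component `a` vanishes on
the facet, then by irreducibility all components vanish at the vertices with positive weight, but
`φ` is positive at the origin. -/
theorem exists_proj_ne_zero (S : Setting Γ μ κ₀ κΓ κh c k) (hδ : Admissible κ₀ κΓ κh k c δ)
    (hη : η ∈ K1Tilde N δ) (hτ : τ ⊆ η)
    (hcomp : IsComplete (phi (gainOp Γ μ) κ₀ κΓ κh) c τ) (a : Fin N) :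
    ∃ y ∈ τ, proj y a ≠ 0 := by
  by_contra hcon
  push Not at hcon
  obtain ⟨lam, hlam, hsol⟩ := hcomp.exists_weights
  have horth := hcomp.2.1
  obtain ⟨hsum, heq⟩ := weights_of_mulVec_eq hsol
  set φ := phi (gainOp Γ μ) κ₀ κΓ κh with hφ
  set Z : Set (Fin N) := {b | ∀ z : τ, lam z ≠ 0 → proj z.1 b = 0} with hZ
  have hfac : ∀ z : τ, 0 < 1 + min 0 ((κΓ - 2 * euclNorm (proj z.1)) /
      (euclNorm (proj z.1) + κ₀)) := fun z =>
    S.factor_pos (euclNorm_nonneg _) (S.norm_lt hδ hη hτ horth hlam hsol z.2)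
  have hφ0 : ∀ z : τ, ∀ b, 0 ≤ φ (proj z.1) b := fun z b =>
    add_nonneg (mul_nonneg (NNReal.coe_nonneg _) (hfac z).le) (le_max_left _ _)
  have hkey : ∀ b ∈ Z, ∀ z : τ, lam z ≠ 0 → φ (proj z.1) b = 0 := by
    intro b hb z hz
    have h1 : ∑ z : τ, lam z * proj z.1 b = 0 := Finset.sum_eq_zero fun z _ => by
      by_cases h : lam z = 0
      · rw [h, zero_mul]
      · rw [hb z h, mul_zero]
    rw [← heq b, Finset.sum_eq_zero_iff_of_nonneg] at h1
    · have h2 := (mul_eq_zero.1 (h1 z (Finset.mem_univ z))).resolve_left hz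
      rcases last_eq_zero_or_one hη (hτ z.2) with h | h
      · rw [h] at h2
        have := S.c_pos b
        linarith
      · rw [h] at h2
        linarith
    · intro z _
      refine mul_nonneg (hlam z) ?_
      rcases last_eq_zero_or_one hη (hτ z.2) with h | h
      · simpa [h] using (S.c_pos b).le
      · simpa [h] using hφ0 z b
  have haZ : a ∈ Z := fun z _ => hcon z.1 z.2
  have huniv : Z = Set.univ := by
    refine eq_univ_of_closed S.irreducible ⟨a, haZ⟩ fun i hi j hij z hz => ?_
    have h1 := hkey i hi z hz
    simp only [hφ, phi] at h1
    have h2 : (0 : ℝ) ≤ gainOp Γ μ (fun j => (proj z.1 j).toNNReal) i := NNReal.coe_nonneg _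
    have h3 := le_max_left 0 (κh - 2 * euclNorm (proj z.1))
    have h4 := mul_nonneg h2 (hfac z).le
    have h5 := (mul_eq_zero.1 (by linarith : (gainOp Γ μ (fun j => (proj z.1 j).toNNReal) i : ℝ) *
      (1 + min 0 ((κΓ - 2 * euclNorm (proj z.1)) / (euclNorm (proj z.1) + κ₀))) = 0)).resolve_right
        (hfac z).ne'
    have h6 := eq_zero_of_gainOp_eq_zero S.gain S.maf (NNReal.coe_eq_zero.1 h5) hij
    rw [Real.toNNReal_eq_zero] at h6
    exact le_antisymm h6 (horth z.1 z.2 j)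
  obtain ⟨z, hz⟩ : ∃ z, lam z ≠ 0 := by
    by_contra h
    push Not at h
    simp [h] at hsum
  have hz0 : proj z.1 = 0 := by
    funext b
    have hb : b ∈ Z := huniv ▸ Set.mem_univ b
    exact hb z hz
  have h1 := hkey a haZ z hz
  rw [hz0] at h1
  exact (S.phi_zero_pos a).ne' h1

end Setting

/-! ### The run of the algorithm -/

/-- The doors of the path-following argument: `τ` is a complete facet of the simplex `η` of the
triangulation. -/
def IsCompleteFacet {N : ℕ} (φ : (Fin N → ℝ) → (Fin N → ℝ)) (c : Fin N → ℝ) (δ : ℝ)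
    (τ η : Finset (Fin (N + 1) → ℝ)) : Prop :=
  IsComplete φ c τ ∧ τ ⊆ η ∧ η ∈ K1Tilde N δ

namespace Setting

variable {N : ℕ} {Γ : Fin N → Fin N → ℝ≥0 → ℝ≥0} {μ : Fin N → (Fin N → ℝ≥0) → ℝ≥0}
  {κ₀ κΓ κh : ℝ} {c : Fin N → ℝ} {k : ℕ} {δ : ℝ} {η τ η₀ τ₀ : Finset (Fin (N + 1) → ℝ)}

theorem inOrthant (S : Setting Γ μ κ₀ κΓ κh c k) (hδ : Admissible κ₀ κΓ κh k c δ)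
    (h : IsCompleteFacet (phi (gainOp Γ μ) κ₀ κΓ κh) c δ τ η) : InOrthant η :=
  inOrthant_of_facet hδ.1 h.2.2 h.2.1 h.1.2.1 (S.exists_proj_ne_zero hδ h.2.2 h.2.1 h.1)

theorem initial_isCompleteFacet (S : Setting Γ μ κ₀ κΓ κh c k)
    (hδ : Admissible κ₀ κΓ κh k c δ) (h₀ : IsInitialSimplex c δ τ) (hη : η ∈ K1Tilde N δ)
    (hτ : τ ⊆ η) : IsCompleteFacet (phi (gainOp Γ μ) κ₀ κΓ κh) c δ τ η :=
  ⟨initial_isComplete _ h₀.1 h₀.2.2.1 h₀.2.2.2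
    (initial_inOrthant hδ.1 hη hτ h₀.2.2.2 S.c_pos), hτ, hη⟩

/-- The starting simplex is the only complete facet in the lower boundary, since such a facet
contains `c`. -/
theorem eq_initial (hδ : Admissible κ₀ κΓ κh k c δ)
    (h₀ : IsInitialSimplex c δ τ₀) (hη₀ : η₀ ∈ K1Tilde N δ) (hτ₀ : τ₀ ⊆ η₀)
    (h : IsCompleteFacet (phi (gainOp Γ μ) κ₀ κΓ κh) c δ τ η) (h0 : OnLevel 0 τ) :
    τ = τ₀ ∧ η = η₀ := by
  refine initial_unique hδ.1 hη₀ hτ₀ h₀.1 h₀.2.2.1 h₀.2.2.2 h.2.2 h.2.1 h.1.1 h0 ?_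
  obtain ⟨lam, hlam, hsol⟩ := h.1.exists_weights
  obtain ⟨hsum, heq⟩ := weights_of_mulVec_eq hsol
  have hc : c = ∑ y : τ, lam y • proj y.1 := by
    funext a
    have h1 := heq a
    have h2 : ∀ y : τ, y.1 (Fin.last N) = 0 := fun y => h0 y.1 y.2
    simp only [h2, sub_zero, one_mul, zero_mul, add_zero, ← Finset.sum_mul, hsum] at h1
    simp [Finset.sum_apply, h1]
  rw [hc]
  exact (convex_convexHull ℝ _).sum_mem (fun y _ => hlam y) hsum
    fun y _ => subset_convexHull ℝ _ ⟨y.1, y.2, rfl⟩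

theorem doorSystem (S : Setting Γ μ κ₀ κΓ κh c k) (hδ : Admissible κ₀ κΓ κh k c δ)
    (h₀ : IsInitialSimplex c δ τ₀) (hη₀ : η₀ ∈ K1Tilde N δ) (hτ₀ : τ₀ ⊆ η₀) :
    DoorSystem (IsCompleteFacet (phi (gainOp Γ μ) κ₀ κΓ κh) c δ) (OnLevel 1) η₀ τ₀ where
  start := S.initial_isCompleteFacet hδ h₀ hη₀ hτ₀
  not_exit h := by
    obtain ⟨y, hy⟩ : τ₀.Nonempty := Finset.card_pos.1 (by rw [h₀.1]; omega)
    have h1 := h y hy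
    rw [h₀.2.2.1 y hy] at h1
    exact zero_ne_one h1
  start_unique r h := (eq_initial hδ h₀ hη₀ hτ₀ h h₀.2.2.1).2
  exit_unique d r r' h1 h h' := eq_of_onLevel_one hδ.1 h.2.2 h'.2.2 h.2.1 h'.2.1 h.1.1 h1
  two_doors r d h := by
    obtain ⟨d', h1, h2, h3, h4⟩ := exists_other_facet (card_of_mem_K1Tilde hδ.1 h.2.2)
      (S.inOrthant hδ h) h.1 h.2.1
    exact ⟨d', ⟨h1, h2, h.2.2⟩, h3, fun d'' h'' => h4 d'' h''.1 h''.2.1⟩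
  two_rooms d r h h1 hne := by
    have h0 : ¬ OnLevel 0 d := fun h0 => hne (eq_initial hδ h₀ hη₀ hτ₀ h h0).1
    obtain ⟨r', h2, h3, h4, h5⟩ := exists_other_simplex hδ.1 h.2.2 h.2.1 h.1.1 h0 h1
    exact ⟨r', ⟨h.1, h3, h2⟩, h4, fun r'' h'' => h5 r'' h''.2.2 h''.2.1⟩
  finite := by
    refine (finite_bounded_simplices (N := N) hδ.1 (κΓ + κ₀ + δ)).subset ?_
    rintro r ⟨d, h⟩
    refine ⟨h.2.2, S.inOrthant hδ h, fun y hy a => ?_⟩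
    obtain ⟨lam, hlam, hsol⟩ := h.1.exists_weights
    obtain ⟨z, hz⟩ : d.Nonempty := Finset.card_pos.1 (by rw [h.1.1]; omega)
    have h1 := S.norm_lt hδ h.2.2 h.2.1 h.1.2.1 hlam hsol hz
    have h2 := le_of_abs_le (abs_le_euclNorm (proj z) a)
    have h3 := le_of_abs_le (abs_proj_sub_le hδ.1 h.2.2 hy (h.2.1 hz) a)
    linarith

/-- A pivot passes to the other complete facet of the current simplex. -/
theorem isPivot_iff (S : Setting Γ μ κ₀ κΓ κh c k) (hδ : Admissible κ₀ κΓ κh k c δ)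
    (h : IsCompleteFacet (phi (gainOp Γ μ) κ₀ κΓ κh) c δ τ η) {τ' : Finset (Fin (N + 1) → ℝ)} :
    (∃ ζ, IsPivot (phi (gainOp Γ μ) κ₀ κΓ κh) c η τ ζ ∧ τ' = η.erase ζ) ↔
      IsCompleteFacet (phi (gainOp Γ μ) κ₀ κΓ κh) c δ τ' η ∧ τ' ≠ τ := by
  rw [exists_isPivot_iff (card_of_mem_K1Tilde hδ.1 h.2.2) (S.inOrthant hδ h) h.1 h.2.1]
  exact ⟨fun h' => ⟨⟨h'.1, h'.2.1, h.2.2⟩, h'.2.2⟩, fun h' => ⟨h'.1.1, h'.1.2.1, h'.2⟩⟩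

/-- Along a run the current facet is complete. -/
theorem isCompleteFacet_of_isRun (S : Setting Γ μ κ₀ κΓ κh c k)
    (hδ : Admissible κ₀ κΓ κh k c δ) {n : ℕ} {r d : ℕ → Finset (Fin (N + 1) → ℝ)}
    (h : IsRun (phi (gainOp Γ μ) κ₀ κΓ κh) c δ n r d) :
    ∀ j ≤ n, IsCompleteFacet (phi (gainOp Γ μ) κ₀ κΓ κh) c δ (d j) (r j) := by
  intro j
  induction j with
  | zero => exact fun _ => S.initial_isCompleteFacet hδ h.1 h.2.1 h.2.2.1
  | succ j ih =>
    intro hj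
    obtain ⟨h1, -, h3, h4, -⟩ := h.2.2.2 j hj
    exact ⟨((S.isPivot_iff hδ (ih (Nat.le_of_succ_le hj))).1 h1).1.1, h4, h3⟩

/-- The runs of the algorithm are the walks through complete facets. -/
theorem isRun_iff (S : Setting Γ μ κ₀ κΓ κh c k) (hδ : Admissible κ₀ κΓ κh k c δ)
    (h₀ : IsInitialSimplex c δ τ₀) (hη₀ : η₀ ∈ K1Tilde N δ) (hτ₀ : τ₀ ⊆ η₀) {n : ℕ}
    {r d : ℕ → Finset (Fin (N + 1) → ℝ)} :
    IsRun (phi (gainOp Γ μ) κ₀ κΓ κh) c δ n r d ↔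
      IsDoorWalk (IsCompleteFacet (phi (gainOp Γ μ) κ₀ κΓ κh) c δ) (OnLevel 1) η₀ τ₀ n r d := by
  constructor
  · intro h
    have hinc := S.isCompleteFacet_of_isRun hδ h
    obtain ⟨h1, h2⟩ := eq_initial hδ h₀ hη₀ hτ₀ (hinc 0 (Nat.zero_le n)) h.1.2.2.1
    refine ⟨h2, h1, fun j hj => ?_⟩
    obtain ⟨h3, h4, -, -, h5⟩ := h.2.2.2 j hj
    exact ⟨(S.isPivot_iff hδ (hinc j hj.le)).1 h3, h4, hinc (j + 1) hj, h5⟩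
  · intro h
    refine ⟨by rw [h.2.1]; exact h₀, by rw [h.1]; exact hη₀, by rw [h.1, h.2.1]; exact hτ₀,
      fun j hj => ?_⟩
    obtain ⟨h1, h2, h3, h4⟩ := h.2.2 j hj
    have hinc := (S.doorSystem hδ h₀ hη₀ hτ₀).inc_walk h hj.le
    exact ⟨(S.isPivot_iff hδ hinc).2 h1, h2, h3.2.2, h3.2.1, h4⟩

theorem completeGraph_adj_iff {φ : (Fin N → ℝ) → (Fin N → ℝ)}
    (a b : Finset (Fin (N + 1) → ℝ)) :
    (completeGraph φ c δ).Adj a b ↔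
      a ≠ b ∧ ∃ d, IsCompleteFacet φ c δ d a ∧ IsCompleteFacet φ c δ d b := by
  constructor
  · rintro ⟨hne, ha, hb, d, hd, h1, h2⟩
    exact ⟨hne, d, ⟨hd, h1, ha⟩, ⟨hd, h2, hb⟩⟩
  · rintro ⟨hne, d, ⟨hd, h1, ha⟩, ⟨-, h2, hb⟩⟩
    exact ⟨hne, ha, hb, d, hd, h1, h2⟩

/-- The algorithm follows the path of the starting simplex and stops at its other end. -/
theorem exists_run (S : Setting Γ μ κ₀ κΓ κh c k) (hδ : Admissible κ₀ κΓ κh k c δ) :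
    ∃ (m : ℕ) (η τ : ℕ → Finset (Fin (N + 1) → ℝ)) (τ' : Finset (Fin (N + 1) → ℝ)),
      0 < m ∧
      IsRun (phi (gainOp Γ μ) κ₀ κΓ κh) c δ m η τ ∧
      StopsAt (phi (gainOp Γ μ) κ₀ κΓ κh) c (η m) (τ m) τ' ∧
      (∀ n η₁ τ₁, IsRun (phi (gainOp Γ μ) κ₀ κΓ κh) c δ n η₁ τ₁ →
        n ≤ m ∧ ∀ j ≤ n, η₁ j = η j ∧ τ₁ j = τ j) ∧
      IsFiniteSimplePath (completeGraph (phi (gainOp Γ μ) κ₀ κΓ κh) c δ) m η ∧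
      (∀ j ≤ m, InOrthant (η j) ∧ IsComplete (phi (gainOp Γ μ) κ₀ κΓ κh) c (τ j)) ∧
      IsComplete (phi (gainOp Γ μ) κ₀ κΓ κh) c τ' ∧
      ∃ w, IsApproxFixedPoint (phi (gainOp Γ μ) κ₀ κΓ κh) c τ' w := by
  obtain ⟨τ₀, h₀⟩ := hδ.2.2
  obtain ⟨η₀, hη₀, hτ₀⟩ := h₀.2.1
  have D := S.doorSystem hδ h₀ hη₀ hτ₀
  obtain ⟨m, η, τ, τ', hw, he, hne, hex⟩ := D.exists_walk_exit
  have hinc : ∀ j ≤ m, _ := fun j hj => D.inc_walk hw hj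
  refine ⟨m, η, τ, τ', ?_, (S.isRun_iff hδ h₀ hη₀ hτ₀).2 hw,
    ⟨(S.isPivot_iff hδ (hinc m le_rfl)).2 ⟨he, hne⟩, hex⟩, ?_,
    D.isFiniteSimplePath _ completeGraph_adj_iff hw he hne hex,
    fun j hj => ⟨S.inOrthant hδ (hinc j hj), (hinc j hj).1⟩, he.1, ?_⟩
  · -- Two facets of a simplex of dimension at least two share a vertex, so the second facet cannot
    -- lie in the upper boundary.
    refine Nat.pos_of_ne_zero ?_
    rintro rfl
    rw [hw.1] at he
    have h1 : (τ₀ ∩ τ').Nonempty := by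
      rw [← Finset.card_pos]
      have h2 := Finset.card_union_add_card_inter τ₀ τ'
      have h3 := Finset.card_le_card (Finset.union_subset hτ₀ he.2.1)
      rw [card_of_mem_K1Tilde hδ.1 hη₀] at h3
      rw [h₀.1, he.1.1] at h2
      have := S.one_le
      omega
    obtain ⟨y, hy⟩ := h1
    rw [Finset.mem_inter] at hy
    have h4 := hex y hy.2
    rw [h₀.2.2.1 y hy.1] at h4
    exact zero_ne_one h4
  · intro n η₁ τ₁ hrun
    have hw₁ := (S.isRun_iff hδ h₀ hη₀ hτ₀).1 hrun
    have hn := D.walk_le hw he hne hex hw₁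
    exact ⟨hn, D.walk_unique ⟨hw.1, hw.2.1, fun j hj => hw.2.2 j (hj.trans_le hn)⟩ hw₁⟩
  · obtain ⟨lam, hlam, hsol⟩ := he.1.exists_weights
    exact ⟨_, lam, hlam, hsol, rfl⟩

/-! ### Convergence of the outputs -/

/-- An output is a convex combination of values of `φ` at vertices which are at distance at most
`δ` from it. -/
theorem output_spec (S : Setting Γ μ κ₀ κΓ κh c k) (hδ : Admissible κ₀ κΓ κh k c δ)
    {w : Fin N → ℝ} (hw : IsOutput (phi (gainOp Γ μ) κ₀ κΓ κh) c δ w) :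
    0 ≤ w ∧ w ∈ Metric.closedBall 0 (κΓ + κ₀) ∧
      ∀ (x : Fin N → ℝ) (ε ρ : ℝ),
        (∀ v, dist v x < ρ → dist (phi (gainOp Γ μ) κ₀ κΓ κh v)
          (phi (gainOp Γ μ) κ₀ κΓ κh x) ≤ ε) →
        dist w x + δ < ρ → dist w (phi (gainOp Γ μ) κ₀ κΓ κh x) ≤ ε := by
  obtain ⟨m, η, τ, τ', hrun, ⟨hpiv, hex⟩, lam, hlam, hsol, rfl⟩ := hw
  have hinc := ((S.isPivot_iff hδ (S.isCompleteFacet_of_isRun hδ hrun m le_rfl)).1 hpiv).1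
  have horth := hinc.1.2.1
  obtain ⟨hsum, heq⟩ := weights_of_mulVec_eq hsol
  set w := ∑ y : τ', lam y • proj y.1 with hwdef
  refine ⟨Finset.sum_nonneg fun y _ => smul_nonneg (hlam y) (horth y.1 y.2), ?_, ?_⟩
  · refine (convex_closedBall _ _).sum_mem (fun y _ => hlam y) hsum fun y _ => ?_
    have h1 := S.norm_lt hδ hinc.2.2 hinc.2.1 horth hlam hsol y.2
    have h2 := (euclNorm_nonneg _).trans h1.le
    rw [mem_closedBall_zero_iff, pi_norm_le_iff_of_nonneg h2]
    exact fun a => (abs_le_euclNorm (proj y.1) a).trans h1.le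
  · intro x ε ρ hε hρ
    have hw2 : w = ∑ y : τ', lam y • phi (gainOp Γ μ) κ₀ κΓ κh (proj y.1) := by
      funext a
      have h1 := heq a
      have h2 : ∀ y : τ', y.1 (Fin.last N) = 1 := fun y => hex y.1 y.2
      simp only [h2, sub_self, zero_mul, one_mul, zero_add] at h1
      simp only [hwdef, Finset.sum_apply, Pi.smul_apply, smul_eq_mul, h1]
    rw [hw2, ← Metric.mem_closedBall]
    refine (convex_closedBall _ _).sum_mem (fun y _ => hlam y) hsum fun y _ => ?_
    rw [Metric.mem_closedBall]
    apply hε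
    have h3 : w ∈ Metric.closedBall (proj y.1) δ := by
      refine (convex_closedBall _ _).sum_mem (fun y _ => hlam y) hsum fun z _ => ?_
      rw [Metric.mem_closedBall, dist_pi_le_iff hδ.1.le]
      intro a
      rw [Real.dist_eq]
      exact abs_proj_sub_le hδ.1 hinc.2.2 (hinc.2.1 z.2) (hinc.2.1 y.2) a
    rw [Metric.mem_closedBall, dist_comm] at h3
    linarith [dist_triangle (proj y.1) w x]

variable {δs : ℕ → ℝ} {w : ℕ → Fin N → ℝ}

/-- Cluster points of the outputs are fixed points of `φ` in the orthant, hence decay points. -/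
theorem cluster_fixed (S : Setting Γ μ κ₀ κΓ κh c k) (hδ : ∀ n, Admissible κ₀ κΓ κh k c (δs n))
    (hlim : Filter.Tendsto δs Filter.atTop (nhds 0))
    (hw : ∀ n, IsOutput (phi (gainOp Γ μ) κ₀ κΓ κh) c (δs n) (w n)) {x : Fin N → ℝ}
    (hx : MapClusterPt x Filter.atTop w) :
    ∃ s ∈ decaySet (gainOp Γ μ), phi (gainOp Γ μ) κ₀ κΓ κh (toReal s) = toReal s ∧
      toReal s = x := by
  rw [mapClusterPt_iff_frequently] at hx
  have hx0 : 0 ≤ x := by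
    by_contra hneg
    obtain ⟨n, hn⟩ := (hx _ (isClosed_Ici.isOpen_compl.mem_nhds hneg)).exists
    exact hn (S.output_spec (hδ n) (hw n)).1
  have hfix : phi (gainOp Γ μ) κ₀ κΓ κh x = x := by
    rw [← dist_le_zero]
    refine le_of_forall_pos_le_add fun ε hε => ?_
    obtain ⟨ρ, hρ, hcont⟩ := Metric.continuous_iff.1 S.phi_continuous x (ε / 2) (half_pos hε)
    have h1 := hx (Metric.ball x (min (ρ / 2) (ε / 2)))
      (Metric.ball_mem_nhds _ (lt_min (half_pos hρ) (half_pos hε)))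
    have h2 : ∀ᶠ n in Filter.atTop, δs n < ρ / 2 := hlim.eventually_lt_const (half_pos hρ)
    obtain ⟨n, hn, hnδ⟩ := (h1.and_eventually h2).exists
    rw [Metric.mem_ball, lt_min_iff] at hn
    have h3 := (S.output_spec (hδ n) (hw n)).2.2 x (ε / 2) ρ (fun v hv => (hcont v hv).le)
      (by linarith)
    rw [dist_comm] at h3
    linarith [dist_triangle (phi (gainOp Γ μ) κ₀ κΓ κh x) (w n) x]
  have hsx : toReal (fun j => (x j).toNNReal) = x :=
    funext fun j => Real.coe_toNNReal _ (hx0 j)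
  exact ⟨_, S.decay_of_fixed hx0 hfix, by rw [hsx, hfix], hsx⟩

/-- Subsequences of the outputs have convergent subsequences, whose limits are cluster points. -/
theorem exists_convergent (S : Setting Γ μ κ₀ κΓ κh c k)
    (hδ : ∀ n, Admissible κ₀ κΓ κh k c (δs n))
    (hw : ∀ n, IsOutput (phi (gainOp Γ μ) κ₀ κΓ κh) c (δs n) (w n)) {ν : ℕ → ℕ}
    (hν : Filter.Tendsto ν Filter.atTop Filter.atTop) :
    ∃ x, MapClusterPt x Filter.atTop w ∧ ∃ ψ : ℕ → ℕ, StrictMono ψ ∧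
      Filter.Tendsto (fun n => w (ν (ψ n))) Filter.atTop (nhds x) := by
  obtain ⟨x, -, ψ, hψ, h⟩ := (isCompact_closedBall (0 : Fin N → ℝ) (κΓ + κ₀)).tendsto_subseq
    (x := fun n => w (ν n)) fun n => (S.output_spec (hδ _) (hw _)).2.1
  refine ⟨x, ?_, ψ, hψ, h⟩
  exact (Filter.Tendsto.mapClusterPt h).of_comp (hν.comp hψ.tendsto_atTop)

theorem convergence (S : Setting Γ μ κ₀ κΓ κh c k)
    (hδ : ∀ n, Admissible κ₀ κΓ κh k c (δs n))
    (hlim : Filter.Tendsto δs Filter.atTop (nhds 0))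
    (hw : ∀ n, IsOutput (phi (gainOp Γ μ) κ₀ κΓ κh) c (δs n) (w n)) :
    (∃ s ∈ decaySet (gainOp Γ μ), phi (gainOp Γ μ) κ₀ κΓ κh (toReal s) = toReal s ∧
      ∃ ψ : ℕ → ℕ, StrictMono ψ ∧
        Filter.Tendsto (fun n => w (ψ n)) Filter.atTop (nhds (toReal s))) ∧
    Filter.Tendsto (fun n => Metric.infDist (w n)
      (toReal '' {s | s ∈ decaySet (gainOp Γ μ) ∧
        phi (gainOp Γ μ) κ₀ κΓ κh (toReal s) = toReal s})) Filter.atTop (nhds 0) ∧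
    ∀ᶠ n in Filter.atTop, ∃ s ∈ decaySet (gainOp Γ μ), w n = toReal s := by
  refine ⟨?_, ?_, ?_⟩
  · obtain ⟨x, hx, ψ, hψ, h⟩ := S.exists_convergent hδ hw (ν := id) Filter.tendsto_id
    obtain ⟨s, hs, hfix, rfl⟩ := S.cluster_fixed hδ hlim hw hx
    exact ⟨s, hs, hfix, ψ, hψ, h⟩
  · refine Filter.tendsto_of_subseq_tendsto fun ν hν => ?_
    obtain ⟨x, hx, ψ, -, h⟩ := S.exists_convergent hδ hw hν
    obtain ⟨s, hs, hfix, rfl⟩ := S.cluster_fixed hδ hlim hw hx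
    set F := toReal '' {s | s ∈ decaySet (gainOp Γ μ) ∧
      phi (gainOp Γ μ) κ₀ κΓ κh (toReal s) = toReal s}
    have hsF : toReal s ∈ F := ⟨s, ⟨hs, hfix⟩, rfl⟩
    have h1 := ((Metric.continuous_infDist_pt F).tendsto (toReal s)).comp h
    rw [Metric.infDist_zero_of_mem hsF] at h1
    exact ⟨ψ, h1⟩
  · set U : Set (Fin N → ℝ) := {v | ∀ i, gainOp Γ μ (fun j => (v j).toNNReal) i < (v i).toNNReal}
      with hU
    have hopen : IsOpen U := by
      have h1 : Continuous fun (v : Fin N → ℝ) (j : Fin N) => (v j).toNNReal :=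
        continuous_pi fun j => continuous_real_toNNReal.comp (continuous_apply j)
      simp only [hU, Set.ofPred_forall]
      refine isOpen_iInter_of_finite fun i => isOpen_lt ?_ ((continuous_apply i).comp h1)
      exact (continuous_apply i).comp ((gainOp_continuous S.gain S.maf).comp h1)
    have hev : ∀ᶠ n in Filter.atTop, w n ∈ U := by
      by_contra hcon
      obtain ⟨ν, hν, hnot⟩ := Filter.extraction_of_frequently_atTop
        (Filter.not_eventually.1 hcon)
      obtain ⟨x, hx, ψ, -, h⟩ := S.exists_convergent hδ hw hν.tendsto_atTop
      obtain ⟨s, hs, -, rfl⟩ := S.cluster_fixed hδ hlim hw hx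
      have hsU : toReal s ∈ U := by
        intro i
        simp only [toReal, Real.toNNReal_coe]
        exact hs i
      obtain ⟨n, hn⟩ := (h.eventually (hopen.mem_nhds hsU)).exists
      exact hnot _ hn
    filter_upwards [hev] with n hn
    exact ⟨fun j => (w n j).toNNReal, hn,
      funext fun j => (Real.coe_toNNReal _ ((S.output_spec (hδ n) (hw n)).1 j)).symm⟩

end Setting

end SFP

theorem mainTheorem1 (N : ℕ) (hN : 1 ≤ N)
    (Γ : Fin N → Fin N → ℝ≥0 → ℝ≥0) (hΓ : SFP.IsGainMatrix Γ)
    (hirr : SFP.IsIrreducibleMatrix (SFP.adjMatrix Γ))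
    (μ : Fin N → (Fin N → ℝ≥0) → ℝ≥0) (hμ : ∀ i, SFP.IsMAF (μ i))
    (hsg : SFP.SmallGain (SFP.gainOp Γ μ))
    (κ₀ κΓ κh : ℝ) (hκ₀ : 0 < κ₀) (hκh : 0 < κh) (hκ : κh < κΓ)
    (φ : (Fin N → ℝ) → (Fin N → ℝ)) (hφ : φ = SFP.phi (SFP.gainOp Γ μ) κ₀ κΓ κh)
    (c : Fin N → ℝ) (hc0 : 0 ≤ c) (hc : SFP.euclNorm c < κΓ / 2)
    (k : ℕ) (hk1 : 1 ≤ k)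
    (hk : (1 / (2 * (k : ℝ) - 1)) •
      SFP.toReal (SFP.gainOp Γ μ (fun _ => (κΓ + κ₀).toNNReal)) < c) :
    -- the path and the run of the algorithm for a fixed mesh
    (∀ δ : ℝ, SFP.Admissible κ₀ κΓ κh k c δ →
      ∃ (m : ℕ) (η τ : ℕ → Finset (Fin (N + 1) → ℝ)) (τ' : Finset (Fin (N + 1) → ℝ)),
        0 < m ∧
        SFP.IsRun φ c δ m η τ ∧ SFP.StopsAt φ c (η m) (τ m) τ' ∧
        (∀ n η₁ τ₁, SFP.IsRun φ c δ n η₁ τ₁ →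
          n ≤ m ∧ ∀ j ≤ n, η₁ j = η j ∧ τ₁ j = τ j) ∧
        SFP.IsFiniteSimplePath (SFP.completeGraph φ c δ) m η ∧
        (∀ j ≤ m, SFP.InOrthant (η j) ∧ SFP.IsComplete φ c (τ j)) ∧
        SFP.IsComplete φ c τ' ∧
        ∃ w, SFP.IsApproxFixedPoint φ c τ' w) ∧
    -- convergence under refinement of the mesh
    (∀ δ : ℕ → ℝ, (∀ n, SFP.Admissible κ₀ κΓ κh k c (δ n)) →
      Filter.Tendsto δ Filter.atTop (nhds 0) →
      ∀ w : ℕ → Fin N → ℝ, (∀ n, SFP.IsOutput φ c (δ n) (w n)) →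
        (∃ s ∈ SFP.decaySet (SFP.gainOp Γ μ), φ (SFP.toReal s) = SFP.toReal s ∧
          ∃ ψ : ℕ → ℕ, StrictMono ψ ∧
            Filter.Tendsto (fun n => w (ψ n)) Filter.atTop (nhds (SFP.toReal s))) ∧
        (∀ x : Fin N → ℝ, MapClusterPt x Filter.atTop w →
          ∃ s ∈ SFP.decaySet (SFP.gainOp Γ μ), φ (SFP.toReal s) = SFP.toReal s ∧
            SFP.toReal s = x) ∧
        Filter.Tendsto
          (fun n => Metric.infDist (w n)
            (SFP.toReal '' {s | s ∈ SFP.decaySet (SFP.gainOp Γ μ) ∧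
              φ (SFP.toReal s) = SFP.toReal s}))
          Filter.atTop (nhds 0) ∧
        (∀ᶠ n in Filter.atTop,
          ∃ s ∈ SFP.decaySet (SFP.gainOp Γ μ), w n = SFP.toReal s)) := by
  subst hφ
  have S : SFP.Setting Γ μ κ₀ κΓ κh c k :=
    ⟨hN, hΓ, hirr, hμ, hsg, hκ₀, hκh, hκ, hc0, hc, hk1, hk⟩
  refine ⟨fun δ hδ => S.exists_run hδ, fun δ hδ hlim w hw => ?_⟩
  obtain ⟨h1, h2, h3⟩ := S.convergence hδ hlim hw
  exact ⟨h1, fun x hx => S.cluster_fixed hδ hlim hw hx, h2, h3⟩
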